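/- Let $H$ be a real Hilbert space and let $A$ be a nonnegative self-adjoint (in general unbounded) linear operator on $H$ with dense domain $D(A)$. For $x\in H$ let $\mu_x$ denote the spectral measure of $x$ with respect to $A$, namely the finite Borel measure on $[0,+\infty)$ with $\langle (A+s)^{-1}x,x\rangle=\int (l+s)^{-1}\,d\mu_x(l)$ for every $s>0$. For $\alpha\ge 0$, $r>0$ and $\varphi:[0,+\infty)\to[1,+\infty)$ set $$D(A^\alpha)=\Big\{x\in H:\ |A^\alpha x|^2:=\int l^{2\alpha}\,d\mu_x(l)<+\infty\Big\},\qquad \mathcal G_{\varphi,r,\alpha}(A)=\Big\{x\in H:\ \int l^{2\alpha}\exp\big(r\varphi(\sqrt l)\big)\,d\mu_x(l)<+\infty\Big\}$$ (it is understood that the integrand is $\mu_x$-measurable), and $\mathcal G_{\varphi,\infty,\alpha}(A)=\bigcap_{r>0}\mathcal G_{\varphi,r,\alpha}(A)$; the space $D(A^\alpha)$ carries the norm $|x|+|A^\alpha x|$. (If $A$ has a complete orthonormal system of eigenvectors with eigenvalues $\lambda_k^2$, $\lambda_k\ge0$, and $x$ has components $x_k$, these integrals are $\sum_k\lambda_k^{4\alpha}x_k^2$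 and $\sum_k\lambda_k^{4\alpha}x_k^2\exp(r\varphi(\lambda_k))$.) **Theorem (Derivative loss: strictly hyperbolic case).** Assume that there exist a countable (not necessarily complete) orthonormal system $\{e_k\}_{k\ge1}$ in $H$ and a nondecreasing unbounded sequence $\{\lambda_k\}_{k\ge1}$ of positive real numbers such that $Ae_k=\lambda_k^2e_k$ for every $k\ge1$. Let $\omega:[0,+\infty)\to[0,+\infty)$ be a continuity modulus, i.e. a continuous nondecreasing function with $\omega(0)=0$ and $\omega(a+b)\le\omega(a)+\omega(b)$ for all $a,b\ge0$, such that $\sigma\mapsto\sigma/\omega(\sigma)$ is nondecreasing on $(0,+\infty)$. Let $\varphi:[0,+\infty)\to[1,+\infty)$ be a function such that $$\lim_{k\to+\infty}\frac{\lambda_k}{\varphi(\lambda_k)}\,\omega\!\left(\frac1{\lambda_k}\right)=+\infty .$$ Then there exist a function $m:[0,+\infty)\to[1/2,3/2]$ which is $\omega$-continuous, i.e. $|m(a)-m(b)|\le L\,\omega(|a-b|)$ for all $a,b\ge0$ and some constant $L$, a number $T_0>0$, and a solution $$u\in C^1\big([0,T_0];D(A^{1/4})\big)\cap C^0\big([0,T_0];D(A^{3/4})\big)$$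 of the equation $$u''(t)+m\big(|A^{1/2}u(t)|^2\big)Au(t)=0,\qquad t\in[0,T_0],$$ understood in the weak sense, i.e. $\frac{d}{dt}\langle u'(t),y\rangle=-m\big(|A^{1/2}u(t)|^2\big)\langle u(t),Ay\rangle$ for every $y\in D(A)$ and $t\in[0,T_0]$, which has instantaneous strong derivative loss of type $\mathcal G_{\varphi,\infty,3/4}(A)\times\mathcal G_{\varphi,\infty,1/4}(A)\to D(A^{3/4})\times D(A^{1/4})$, namely $$(u(0),u'(0))\in\mathcal G_{\varphi,\infty,3/4}(A)\times\mathcal G_{\varphi,\infty,1/4}(A)$$ and $$(u(t),u'(t))\notin D(A^{3/4+\varepsilon})\times D(A^{1/4+\varepsilon})\qquad\forall\varepsilon>0,\ \forall t\in(0,T_0].$$ -/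

import Mathlib

open Set Filter Topology MeasureTheory
open scoped ENNReal

namespace Kirchhoff

variable {H : Type*} [NormedAddCommGroup H] [InnerProductSpace ℝ H]

/-- `A` is nonnegative: `⟨A x, x⟩ ≥ 0` for every `x ∈ D(A)`. -/
def IsNonneg (A : H →ₗ.[ℝ] H) : Prop :=
  ∀ x : A.domain, 0 ≤ inner ℝ (A x) (x : H)

/-- `ν` is the spectral measure of the vector `x` with respect to the nonnegative self-adjoint
operator `A`, i.e. `ν(B) = ⟨E(B) x, x⟩` where `E` is the resolution of the identity of `A`.
It is characterized as the finite Borel measure carried by `[0, ∞)` whose Stieltjes transform is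
`∫ (l + s)⁻¹ dν(l) = ⟨(A + s)⁻¹ x, x⟩` for every `s > 0`; here `y = (A + s)⁻¹ x`.
By the spectral theorem it exists for every `x`, and a finite measure on `[0, ∞)` is determined by
its Stieltjes transform. If `A` is represented as the multiplication by a function `b ≥ 0` on some
`L²(M, μ)`, and `x` corresponds to `f`, then `ν` is the image under `b` of the measure `f² μ`. -/
structure IsSpectralMeasure (A : H →ₗ.[ℝ] H) (x : H) (ν : Measure ℝ) : Prop where
  finite : IsFiniteMeasure ν
  nonneg : ν (Iio 0) = 0
  resolvent : ∀ s : ℝ, 0 < s → ∃ y : A.domain, A y + s • (y : H) = x ∧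
    ∫ l, (l + s)⁻¹ ∂ν = inner ℝ (y : H) x

open Classical in
/-- The spectral measure of `x` with respect to `A`. -/
noncomputable def spectralMeasure (A : H →ₗ.[ℝ] H) (x : H) : Measure ℝ :=
  if h : ∃ ν, IsSpectralMeasure A x ν then h.choose else 0

/-- The domain `D(f(A))` of the functional calculus: `x ∈ D(f(A))` iff `f` is square integrable
with respect to the spectral measure of `x`. -/
def funDomain (A : H →ₗ.[ℝ] H) (f : ℝ → ℝ) : Set H :=
  {x | MemLp f 2 (spectralMeasure A x)}

/-- The norm `|f(A) x|`, equal to the `L²` norm of `f` with respect to the spectral measure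
of `x`. -/
noncomputable def funNorm (A : H →ₗ.[ℝ] H) (f : ℝ → ℝ) (x : H) : ℝ≥0∞ :=
  eLpNorm f 2 (spectralMeasure A x)

/-- `D(A^α)`, for `α ≥ 0`. -/
def powDomain (A : H →ₗ.[ℝ] H) (α : ℝ) : Set H :=
  funDomain A (fun l => l ^ α)

/-- The norm `|x| + |A^α x|` of the space `D(A^α)` (equivalent to the Hilbert space norm
`(|x|² + |A^α x|²)^{1/2}`). -/
noncomputable def powNorm (A : H →ₗ.[ℝ] H) (α : ℝ) (x : H) : ℝ≥0∞ :=
  ‖x‖ₑ + funNorm A (fun l => l ^ α) x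

/-- The real number `|A^{1/2} x|²`, for `x ∈ D(A^{1/2})`. -/
noncomputable def sqNormHalf (A : H →ₗ.[ℝ] H) (x : H) : ℝ :=
  (funNorm A (fun l => l ^ (1 / 2 : ℝ)) x).toReal ^ 2

/-- The generalized Gevrey space `G_{φ,r,α}(A)`: if `A e_k = λ_k² e_k` for a complete orthonormal
system, the condition is that `∑ λ_k^{4α} u_k² exp(r φ(λ_k))` is finite. -/
def gevrey (A : H →ₗ.[ℝ] H) (φ : ℝ → ℝ) (r α : ℝ) : Set H :=
  funDomain A (fun l => l ^ α * Real.exp (r * φ (Real.sqrt l) / 2))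

/-- `G_{φ,∞,α}(A)`, the intersection of the spaces `G_{φ,r,α}(A)` over all `r > 0`. -/
def gevreyInfty (A : H →ₗ.[ℝ] H) (φ : ℝ → ℝ) (α : ℝ) : Set H :=
  {x | ∀ r : ℝ, 0 < r → x ∈ gevrey A φ r α}

/-- `v ∈ C⁰([0,T]; D(A^α))`. -/
def ContInPow (A : H →ₗ.[ℝ] H) (α T : ℝ) (v : ℝ → H) : Prop :=
  ∀ t ∈ Icc 0 T, v t ∈ powDomain A α ∧
    Tendsto (fun s => powNorm A α (v s - v t)) (𝓝[Icc 0 T] t) (𝓝 0)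

/-- `u ∈ C¹([0,T]; D(A^α))`, with derivative `u'`. -/
def ContDiffInPow (A : H →ₗ.[ℝ] H) (α T : ℝ) (u u' : ℝ → H) : Prop :=
  ContInPow A α T u ∧ ContInPow A α T u' ∧
    ∀ t ∈ Icc 0 T,
      Tendsto (fun s => powNorm A α ((s - t)⁻¹ • (u s - u t) - u' t))
        (𝓝[Icc 0 T \ {t}] t) (𝓝 0)

/-- `u ∈ C¹([0,T]; D(A^{1/4})) ∩ C⁰([0,T]; D(A^{3/4}))`, with derivative `u'`, solves
`u'' + m(|A^{1/2} u|²) A u = 0` in `[0,T]`. As `A u(t)` lies only in the dual `D(A^{-1/4})` of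
`D(A^{1/4})`, the equation is tested against the vectors of `D(A)`, which are dense
in `D(A^{1/4})`. -/
structure IsSolution (A : H →ₗ.[ℝ] H) (m : ℝ → ℝ) (T : ℝ) (u u' : ℝ → H) : Prop where
  contDiff : ContDiffInPow A (1 / 4) T u u'
  cont : ContInPow A (3 / 4) T u
  equation : ∀ y : A.domain, ∀ t ∈ Icc 0 T,
    HasDerivWithinAt (fun s => inner ℝ (u' s) (y : H))
      (-(m (sqNormHalf A (u t)) * inner ℝ (u t) (A y))) (Icc 0 T) t

/-- `u` is a solution of `u'' + m(|A^{1/2} u|²) A u = 0` with instantaneous strong derivative loss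
of type `G_{φ,∞,3/4}(A) × G_{φ,∞,1/4}(A) → D(A^{α+1/2}) × D(A^α)`. -/
def HasStrongDerivativeLoss (A : H →ₗ.[ℝ] H) (m φ : ℝ → ℝ) (α : ℝ) (u : ℝ → H) : Prop :=
  ∃ T₀ : ℝ, 0 < T₀ ∧ ∃ u' : ℝ → H,
    IsSolution A m T₀ u u' ∧
    u 0 ∈ gevreyInfty A φ (3 / 4) ∧ u' 0 ∈ gevreyInfty A φ (1 / 4) ∧
    ∀ ε : ℝ, 0 < ε → ∀ t ∈ Ioc 0 T₀,
      ¬ (u t ∈ powDomain A (α + 1 / 2 + ε) ∧ u' t ∈ powDomain A (α + ε))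

/-- Continuity moduli on `[0, ∞)`. -/
structure IsContinuityModulus (ω : ℝ → ℝ) : Prop where
  nonneg : ∀ s, 0 ≤ s → 0 ≤ ω s
  continuousOn : ContinuousOn ω (Ici 0)
  monotoneOn : MonotoneOn ω (Ici 0)
  zero : ω 0 = 0
  subadd : ∀ a b, 0 ≤ a → 0 ≤ b → ω (a + b) ≤ ω a + ω b

/-- `m`, as a function on `[0, ∞)`, is `ω`-continuous. -/
def OmegaContinuous (ω m : ℝ → ℝ) : Prop :=
  ∃ L : ℝ, ∀ a b, 0 ≤ a → 0 ≤ b → |m a - m b| ≤ L * ω |a - b|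

end Kirchhoff

namespace Kirchhoff

/-! ### Scalar oscillators -/

/-! The nonlinearity is found by reverse engineering. For a coefficient c(t) prescribed in advance,
u'' + c(t) A u = 0 decouples into scalar oscillators, one for each eigenvector. If ψ(t) = |A^{1/2}
u(t)|² has a continuous derivative with ψ'(0) > 0, then ψ has a Lipschitz left inverse τ on some [0,
T] (`exists_lipschitz_leftInverse`), and with m = c ∘ τ the linear solution solves the nonlinear
equation. Since ω is subadditive, m inherits ω-continuity from c.

The coefficient c is 1 minus a sequence of bursts accumulating at t = 0. The n-th burst lives in
[2⁻ⁿ, 2·2⁻ⁿ], is tuned to the frequency μ n, taken from a sparse subsequence of the λ_k, and for n >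
0 has amplitude ε n = ω(1/μ n), the natural size allowed by ω at that frequency. It resonates with
the n-th mode and multiplies its energy by at least exp(2nφ(μ n)) (`IsResonantSeq.le_gain`); the
limit hypothesis on ω and φ is what makes this gain possible in a time of order 2⁻ⁿ. Before its own
burst the mode only meets bursts m > n, with ε m ≤ 1/μ n, which hardly affect it. Afterwards it only
meets the slower bursts m < n, which change the hyperbolic energy at most by a factor exp(128
Σ_{m<n} μ m ε m).

Hence (`IsResonantSeq.exists_mode`) the energy μ(v² + μ²w²) of mode n can start below a multiple of
exp(-2n - 2nφ(μ n)), which puts the data in every Gevrey space, stay below a multiple of exp(-2n),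
which gives convergence in D(A^{3/4}) × D(A^{1/4}), and yet exceed exp(-300 S n) after its burst,
where S is `lossRate`. The sparsity μ n ≥ exp(n S n) makes any extra power of μ n beat exp(-300 S
n), and at a given t > 0 all but finitely many bursts are over: this is the derivative loss. Mode 0
has no burst; its data are chosen to make ψ'(0) positive.

The link with the abstract spaces is that a finite measure on [0, ∞) is determined by its Stieltjes
transform (`measure_eq_of_stieltjes_eq`), so that a combination of eigenvectors has a discrete
spectral measure (`spectralMeasure_diagVec`) and all norms become series. -/

theorem le_mul_exp_of_abs_deriv_le {I : Set ℝ} (hI : Convex ℝ I) {E E' : ℝ → ℝ} {K : ℝ}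
    (hc : ContinuousOn E I) (hd : ∀ x ∈ interior I, HasDerivAt E (E' x) x)
    (hb : ∀ x ∈ interior I, |E' x| ≤ K * E x) {s t : ℝ} (hs : s ∈ I) (ht : t ∈ I) :
    E t ≤ E s * Real.exp (K * |t - s|) := by
  have key (x k : ℝ) : HasDerivAt (fun y => Real.exp (k * y)) (Real.exp (k * x) * k) x := by
    simpa using ((hasDerivAt_id x).const_mul k).exp
  rcases le_total s t with hst | hst
  · have anti : AntitoneOn (fun y => E y * Real.exp (-K * y)) I := by
      refine antitoneOn_of_hasDerivWithinAt_nonpos hI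
        (f' := fun x => E' x * Real.exp (-K * x) + E x * (Real.exp (-K * x) * -K))
        (hc.mul (by fun_prop)) (fun x hx => ((hd x hx).mul (key x _)).hasDerivWithinAt)
        (fun x hx => ?_)
      have := (abs_le.1 (hb x hx)).2
      nlinarith [Real.exp_pos (-K * x)]
    have h := anti hs ht hst
    simp only at h
    rw [abs_of_nonneg (by linarith)]
    calc E t = E t * Real.exp (-K * t) * Real.exp (K * t) := by
          rw [mul_assoc, ← Real.exp_add]; simp
      _ ≤ E s * Real.exp (-K * s) * Real.exp (K * t) := by gcongr
      _ = _ := by rw [mul_assoc, ← Real.exp_add]; ring_nf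
  · have mono : MonotoneOn (fun y => E y * Real.exp (K * y)) I := by
      refine monotoneOn_of_hasDerivWithinAt_nonneg hI
        (f' := fun x => E' x * Real.exp (K * x) + E x * (Real.exp (K * x) * K))
        (hc.mul (by fun_prop)) (fun x hx => ((hd x hx).mul (key x _)).hasDerivWithinAt)
        (fun x hx => ?_)
      have := (abs_le.1 (hb x hx)).1
      nlinarith [Real.exp_pos (K * x)]
    have h := mono ht hs hst
    simp only at h
    rw [abs_of_nonpos (by linarith)]
    calc E t = E t * Real.exp (K * t) * Real.exp (-K * t) := by
          rw [mul_assoc, ← Real.exp_add]; simp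
      _ ≤ E s * Real.exp (K * s) * Real.exp (-K * t) := by gcongr
      _ = _ := by rw [mul_assoc, ← Real.exp_add]; ring_nf

/-- `w` solves `w'' + μ² c(t) w = 0` in `I`, and `v` is its derivative. -/
def IsOscillator (c : ℝ → ℝ) (μ : ℝ) (I : Set ℝ) (w v : ℝ → ℝ) : Prop :=
  ∀ t ∈ I, HasDerivAt w (v t) t ∧ HasDerivAt v (-(μ ^ 2 * c t * w t)) t

/-- The truncation of `x` to `[a, b]`. -/
noncomputable def clip (a b x : ℝ) : ℝ := max a (min x b)

theorem clip_mem {a b : ℝ} (h : a ≤ b) (x : ℝ) : clip a b x ∈ Icc a b :=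
  ⟨le_max_left _ _, max_le h (min_le_right _ _)⟩

theorem clip_of_mem {a b x : ℝ} (h : x ∈ Icc a b) : clip a b x = x := by
  rw [clip, min_eq_left h.2, max_eq_right h.1]

theorem clip_of_le {a b x : ℝ} (h : x ≤ a) : clip a b x = a :=
  max_eq_left ((min_le_left _ _).trans h)

theorem clip_of_ge {a b x : ℝ} (hab : a ≤ b) (h : b ≤ x) : clip a b x = b := by
  rw [clip, min_eq_right h, max_eq_right hab]

theorem abs_clip_sub_clip_le (a b x y : ℝ) : |clip a b x - clip a b y| ≤ |x - y| := by
  refine (abs_max_sub_max_le_max a _ a _).trans ?_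
  rw [sub_self, abs_zero, max_eq_right (abs_nonneg _)]
  refine (abs_min_sub_min_le_max x b y b).trans ?_
  rw [sub_self, abs_zero, max_eq_left (abs_nonneg _)]

theorem abs_clip_le_abs {R : ℝ} (hR : 0 ≤ R) (x : ℝ) : |clip (-R) R x| ≤ |x| := by
  have := abs_clip_sub_clip_le (-R) R x 0
  rwa [clip_of_mem (x := 0) ⟨by linarith, hR⟩, sub_zero, sub_zero] at this

/-- Truncation makes the linear field bounded and globally Lipschitz, so Picard–Lindelöf applies on
the whole interval without smallness. An a priori bound then shows that the truncation is never
active. The interval extends to the left of 0 so that derivatives at the initial time are two-sided.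
-/
theorem exists_isOscillator {c : ℝ → ℝ} (hc : Continuous c) (hc2 : ∀ t, |c t| ≤ 2) (μ : ℝ)
    {t₀ : ℝ} (ht₀ : t₀ ∈ Icc (-1 : ℝ) 2) (p q : ℝ) :
    ∃ w v : ℝ → ℝ, w t₀ = p ∧ v t₀ = q ∧ IsOscillator c μ (Ioo (-1) 2) w v := by
  set K : ℝ := 1 + 2 * μ ^ 2 with hK
  have hK1 : 1 ≤ K := by nlinarith [sq_nonneg μ]
  -- The radius that w² + v² cannot leave: it grows at rate at most `K` on an interval of length 3.
  set R : ℝ := Real.sqrt ((p ^ 2 + q ^ 2) * Real.exp (K * 3)) with hR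
  have hR0 : 0 ≤ R := Real.sqrt_nonneg _
  have hclip (x : ℝ) : |clip (-R) R x| ≤ R := abs_le.2 (clip_mem (by linarith) x)
  have hcμ (t : ℝ) : |μ ^ 2 * c t| ≤ K := by
    rw [abs_mul, abs_of_nonneg (sq_nonneg μ)]
    nlinarith [hc2 t, sq_nonneg μ]
  let f : ℝ → ℝ × ℝ → ℝ × ℝ := fun t z => (clip (-R) R z.2, -(μ ^ 2 * c t * clip (-R) R z.1))
  let k : NNReal := ⟨K, by linarith⟩
  let L : NNReal := ⟨K * R, by positivity⟩
  have hP : IsPicardLindelof f (tmin := -1) (tmax := 2) ⟨t₀, ht₀⟩ (p, q) (L * 3) 0 L k := by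
    refine ⟨fun t _ => ?_, fun z _ => ?_, fun t _ z _ => ?_, ?_⟩
    · refine (LipschitzWith.of_dist_le_mul fun z z' => ?_).lipschitzOnWith
      have h1 : |z.1 - z'.1| ≤ dist z z' := by
        rw [Prod.dist_eq, ← Real.dist_eq]; exact le_max_left _ _
      have h2 : |z.2 - z'.2| ≤ dist z z' := by
        rw [Prod.dist_eq, ← Real.dist_eq]; exact le_max_right _ _
      have h0 : 0 ≤ dist z z' := dist_nonneg
      change dist (f t z) (f t z') ≤ K * dist z z'
      rw [Prod.dist_eq]
      refine max_le ?_ ?_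
      · rw [Real.dist_eq]
        refine (abs_clip_sub_clip_le _ _ _ _).trans ?_
        nlinarith
      · rw [Real.dist_eq]
        have : f t z = (clip (-R) R z.2, -(μ ^ 2 * c t * clip (-R) R z.1)) := rfl
        have e : (f t z).2 - (f t z').2
            = -((μ ^ 2 * c t) * (clip (-R) R z.1 - clip (-R) R z'.1)) := by
          simp only [f]; ring
        rw [e, abs_neg, abs_mul]
        exact mul_le_mul (hcμ t) ((abs_clip_sub_clip_le _ _ _ _).trans h1) (abs_nonneg _)
          (by linarith)
    · simp only [f]; fun_prop
    · change ‖f t z‖ ≤ K * R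
      rw [Prod.norm_def]
      refine max_le ?_ ?_
      · rw [Real.norm_eq_abs]
        refine (hclip _).trans ?_
        nlinarith
      · simp only [f]
        rw [Real.norm_eq_abs, abs_neg, abs_mul]
        exact mul_le_mul (hcμ t) (hclip _) (abs_nonneg _) (by linarith)
    · have : max ((2 : ℝ) - t₀) (t₀ - -1) ≤ 3 := max_le (by linarith [ht₀.1]) (by linarith [ht₀.2])
      simp only [NNReal.coe_mul, NNReal.coe_zero, sub_zero]
      exact mul_le_mul_of_nonneg_left this L.2
  obtain ⟨α, hα0, hα⟩ := hP.exists_eq_forall_mem_Icc_hasDerivWithinAt₀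
  have hα0 : α t₀ = (p, q) := hα0
  have d1 (t : ℝ) (ht : t ∈ Icc (-1 : ℝ) 2) :
      HasDerivWithinAt (fun t => (α t).1) (clip (-R) R (α t).2) (Icc (-1) 2) t := (hα t ht).fst
  have d2 (t : ℝ) (ht : t ∈ Icc (-1 : ℝ) 2) :
      HasDerivWithinAt (fun t => (α t).2) (-(μ ^ 2 * c t * clip (-R) R (α t).1)) (Icc (-1) 2) t :=
    (hα t ht).snd
  have nh (t : ℝ) (ht : t ∈ Ioo (-1 : ℝ) 2) : Icc (-1 : ℝ) 2 ∈ 𝓝 t := Icc_mem_nhds ht.1 ht.2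
  have bound (t : ℝ) (ht : t ∈ Icc (-1 : ℝ) 2) : (α t).1 ^ 2 + (α t).2 ^ 2 ≤ R ^ 2 := by
    have := le_mul_exp_of_abs_deriv_le (convex_Icc (-1 : ℝ) 2) (K := K)
      (E := fun t => (α t).1 ^ 2 + (α t).2 ^ 2)
      (E' := fun t => 2 * (α t).1 * clip (-R) R (α t).2
        + 2 * (α t).2 * (-(μ ^ 2 * c t * clip (-R) R (α t).1)))
      (fun x hx => ((d1 x hx).continuousWithinAt.pow 2).add ((d2 x hx).continuousWithinAt.pow 2))
      (fun x hx => by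
        rw [interior_Icc] at hx
        have e1 := (d1 x (Ioo_subset_Icc_self hx)).hasDerivAt (nh x hx)
        have e2 := (d2 x (Ioo_subset_Icc_self hx)).hasDerivAt (nh x hx)
        convert! (e1.pow 2).add (e2.pow 2) using 1
        simp)
      (fun x hx => by
        have a1 := abs_clip_le_abs hR0 (α x).1
        have a2 := abs_clip_le_abs hR0 (α x).2
        set X := (α x).1
        set Y := (α x).2
        have hcx : |μ ^ 2 * c x| ≤ 2 * μ ^ 2 := by
          rw [abs_mul, abs_of_nonneg (sq_nonneg μ)]
          nlinarith [hc2 x, sq_nonneg μ]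
        calc |2 * X * clip (-R) R Y + 2 * Y * (-(μ ^ 2 * c x * clip (-R) R X))|
            ≤ |2 * X * clip (-R) R Y| + |2 * Y * (-(μ ^ 2 * c x * clip (-R) R X))| :=
              abs_add_le _ _
          _ = 2 * |X| * |clip (-R) R Y| + 2 * |Y| * (|μ ^ 2 * c x| * |clip (-R) R X|) := by
              simp only [abs_mul, abs_neg, abs_two]
          _ ≤ 2 * |X| * |Y| + 2 * |Y| * (2 * μ ^ 2 * |X|) := by gcongr
          _ = K * (2 * |X| * |Y|) := by rw [hK]; ring
          _ ≤ K * (X ^ 2 + Y ^ 2) := by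
              have : 2 * |X| * |Y| ≤ X ^ 2 + Y ^ 2 := by
                nlinarith [sq_nonneg (|X| - |Y|), sq_abs X, sq_abs Y]
              gcongr) ht₀ ht
    refine this.trans ?_
    simp only [hα0]
    rw [hR, Real.sq_sqrt (by positivity)]
    have h3 : |t - t₀| ≤ 3 := abs_le.2 ⟨by linarith [ht.1, ht₀.2], by linarith [ht.2, ht₀.1]⟩
    gcongr
  have b1 (t : ℝ) (ht : t ∈ Icc (-1 : ℝ) 2) : clip (-R) R (α t).1 = (α t).1 :=
    clip_of_mem (abs_le.1 (abs_le_of_sq_le_sq (by nlinarith [bound t ht]) hR0))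
  have b2 (t : ℝ) (ht : t ∈ Icc (-1 : ℝ) 2) : clip (-R) R (α t).2 = (α t).2 :=
    clip_of_mem (abs_le.1 (abs_le_of_sq_le_sq (by nlinarith [bound t ht]) hR0))
  refine ⟨fun t => (α t).1, fun t => (α t).2, by simp [hα0], by simp [hα0], fun t ht => ?_⟩
  have ht' := Ioo_subset_Icc_self ht
  have e1 := (d1 t ht').hasDerivAt (nh t ht)
  have e2 := (d2 t ht').hasDerivAt (nh t ht)
  rw [b2 t ht'] at e1
  rw [b1 t ht'] at e2
  exact ⟨e1, e2⟩

/-- The energy estimate for perturbations of `w'' + μ² w = 0`. -/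
theorem IsOscillator.energy_le {c w v : ℝ → ℝ} {μ K : ℝ} (hμ : 0 < μ) {I : Set ℝ}
    (h : IsOscillator c μ I w v) (hI : Convex ℝ I) (hK : ∀ t ∈ I, μ * |1 - c t| ≤ K)
    {s t : ℝ} (hs : s ∈ I) (ht : t ∈ I) :
    v t ^ 2 + μ ^ 2 * w t ^ 2 ≤ (v s ^ 2 + μ ^ 2 * w s ^ 2) * Real.exp (K * |t - s|) := by
  refine le_mul_exp_of_abs_deriv_le hI (K := K) (E := fun t => v t ^ 2 + μ ^ 2 * w t ^ 2)
    (E' := fun t => 2 * v t * (-(μ ^ 2 * c t * w t)) + μ ^ 2 * (2 * w t * v t))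
    (fun x hx => (((h x hx).2.continuousAt.pow 2).add
      (((h x hx).1.continuousAt.pow 2).const_mul _)).continuousWithinAt) (fun x hx => ?_)
    (fun x hx => ?_) hs ht
  · have := h x (interior_subset hx)
    convert! (this.2.pow 2).add ((this.1.pow 2).const_mul (μ ^ 2)) using 1
    simp
  · have hk := hK x (interior_subset hx)
    have e : 2 * v x * (-(μ ^ 2 * c x * w x)) + μ ^ 2 * (2 * w x * v x)
        = (μ * (1 - c x)) * (2 * (v x * (μ * w x))) := by ring
    rw [e, abs_mul, abs_mul μ, abs_of_pos hμ]
    have h2 : |2 * (v x * (μ * w x))| ≤ v x ^ 2 + μ ^ 2 * w x ^ 2 := by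
      rw [abs_le]; constructor <;> nlinarith [sq_nonneg (v x - μ * w x), sq_nonneg (v x + μ * w x)]
    exact mul_le_mul hk h2 (abs_nonneg _) ((by positivity : (0:ℝ) ≤ μ * |1 - c x|).trans hk)

/-- The hyperbolic energy estimate, for a coefficient which is differentiable in the interior. -/
theorem IsOscillator.hyperbolic_energy_le {c c' w v : ℝ → ℝ} {μ D : ℝ} {I : Set ℝ}
    (h : IsOscillator c μ I w v) (hI : Convex ℝ I) (hc : ContinuousOn c I)
    (hc' : ∀ t ∈ interior I, HasDerivAt c (c' t) t) (hD : ∀ t ∈ interior I, |c' t| ≤ D)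
    (hc1 : ∀ t ∈ I, 1 / 2 ≤ c t) {s t : ℝ} (hs : s ∈ I) (ht : t ∈ I) :
    v t ^ 2 + μ ^ 2 * (c t * w t ^ 2)
      ≤ (v s ^ 2 + μ ^ 2 * (c s * w s ^ 2)) * Real.exp (2 * D * |t - s|) := by
  refine le_mul_exp_of_abs_deriv_le hI (K := 2 * D)
    (E := fun t => v t ^ 2 + μ ^ 2 * (c t * w t ^ 2))
    (E' := fun t => 2 * v t * (-(μ ^ 2 * c t * w t))
      + μ ^ 2 * (c' t * w t ^ 2 + c t * (2 * w t * v t)))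
    (fun x hx => ((h x hx).2.continuousAt.continuousWithinAt.pow 2).add
      (((hc x hx).mul ((h x hx).1.continuousAt.continuousWithinAt.pow 2)).const_mul _))
    (fun x hx => ?_)
    (fun x hx => ?_) hs ht
  · have := h x (interior_subset hx)
    convert! (this.2.pow 2).add (((hc' x hx).mul (this.1.pow 2)).const_mul (μ ^ 2)) using 1
    simp
  -- The mixed terms in w v cancel and only c' survives; since c ≥ 1/2, the energy controls half of
  -- μ² w², whence the rate 2D.
  · have e : 2 * v x * (-(μ ^ 2 * c x * w x)) + μ ^ 2 * (c' x * w x ^ 2 + c x * (2 * w x * v x))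
        = c' x * (μ ^ 2 * w x ^ 2) := by ring
    have hd := hD x hx
    have h1 := hc1 x (interior_subset hx)
    rw [e, abs_mul, abs_of_nonneg (by positivity : 0 ≤ μ ^ 2 * w x ^ 2)]
    have hD0 : 0 ≤ D := (abs_nonneg _).trans hd
    calc |c' x| * (μ ^ 2 * w x ^ 2) ≤ D * (μ ^ 2 * w x ^ 2) := by gcongr
      _ ≤ D * (2 * (v x ^ 2 + μ ^ 2 * (c x * w x ^ 2))) := by
          refine mul_le_mul_of_nonneg_left ?_ hD0
          nlinarith [sq_nonneg (v x), mul_nonneg (mul_nonneg (sq_nonneg μ) (sq_nonneg (w x)))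
            (sub_nonneg.2 h1)]
      _ = _ := by ring

/-! ### The resonant profile -/

/-- The function `x ↦ sin x * exp (ε * growth x)` solves `w'' + (1 - resonance ε x) w = 0`. -/
noncomputable def resonance (ε x : ℝ) : ℝ :=
  6 * ε * (Real.sin x ^ 3 * Real.cos x) + ε ^ 2 * Real.sin x ^ 8

/-- The derivative of `resonance ε`. -/
noncomputable def resonanceDeriv (ε x : ℝ) : ℝ :=
  6 * ε * (3 * Real.sin x ^ 2 * Real.cos x * Real.cos x + Real.sin x ^ 3 * -Real.sin x)
    + ε ^ 2 * (8 * Real.sin x ^ 7 * Real.cos x)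

/-- The primitive of `sin ^ 4` that vanishes at the origin. -/
noncomputable def growth (x : ℝ) : ℝ :=
  3 / 8 * x - 3 / 8 * (Real.sin x * Real.cos x) - 1 / 4 * (Real.sin x ^ 3 * Real.cos x)

theorem hasDerivAt_resonance (ε x : ℝ) :
    HasDerivAt (resonance ε) (resonanceDeriv ε x) x := by
  have hs := Real.hasDerivAt_sin x
  have hc := Real.hasDerivAt_cos x
  have := (((hs.pow 3).mul hc).const_mul (6 * ε)).add ((hs.pow 8).const_mul (ε ^ 2))
  convert! this using 1

theorem hasDerivAt_growth (x : ℝ) : HasDerivAt growth (Real.sin x ^ 4) x := by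
  have hs := Real.hasDerivAt_sin x
  have hc := Real.hasDerivAt_cos x
  have := (((hasDerivAt_id x).const_mul (3 / 8)).sub ((hs.mul hc).const_mul (3 / 8))).sub
    (((hs.pow 3).mul hc).const_mul (1 / 4))
  convert! this using 1
  have := Real.sin_sq_add_cos_sq x
  have e : Real.cos x ^ 2 = 1 - Real.sin x ^ 2 := by linarith
  simp only [Nat.cast_ofNat, mul_one, Pi.pow_apply]
  linear_combination (3 / 8 + 3 / 4 * Real.sin x ^ 2) * e

theorem abs_sin_pow_mul_cos_le (n : ℕ) (x : ℝ) : |Real.sin x ^ n * Real.cos x| ≤ 1 := by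
  rw [abs_mul, abs_pow]
  exact mul_le_one₀ (pow_le_one₀ (abs_nonneg _) (Real.abs_sin_le_one x)) (abs_nonneg _)
    (Real.abs_cos_le_one x)

theorem abs_resonance_le {ε : ℝ} (h0 : 0 ≤ ε) (h1 : ε ≤ 1) (x : ℝ) : |resonance ε x| ≤ 7 * ε := by
  have a := abs_le.1 (abs_sin_pow_mul_cos_le 3 x)
  have b : Real.sin x ^ 8 ≤ 1 := by
    rw [← Even.pow_abs (by decide)]
    exact pow_le_one₀ (abs_nonneg _) (Real.abs_sin_le_one x)
  have b0 : 0 ≤ Real.sin x ^ 8 := by positivity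
  have : ε ^ 2 ≤ ε := by nlinarith
  rw [abs_le, resonance]
  constructor <;> nlinarith [mul_le_mul_of_nonneg_left b (sq_nonneg ε)]

theorem abs_resonanceDeriv_le {ε : ℝ} (h0 : 0 ≤ ε) (h1 : ε ≤ 1) (x : ℝ) :
    |resonanceDeriv ε x| ≤ 32 * ε := by
  have a := abs_le.1 (abs_sin_pow_mul_cos_le 7 x)
  have s2 : Real.sin x ^ 2 ≤ 1 := Real.sin_sq_le_one x
  have c2 : Real.cos x ^ 2 = 1 - Real.sin x ^ 2 := by linarith [Real.sin_sq_add_cos_sq x]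
  have s0 : 0 ≤ Real.sin x ^ 2 := sq_nonneg _
  have : ε ^ 2 ≤ ε := by nlinarith
  have e : resonanceDeriv ε x = 6 * ε * (3 * Real.sin x ^ 2 * Real.cos x ^ 2
      - (Real.sin x ^ 2) ^ 2) + 8 * ε ^ 2 * (Real.sin x ^ 7 * Real.cos x) := by
    rw [resonanceDeriv]; ring
  rw [e, c2]
  generalize Real.sin x ^ 2 = y at *
  -- A crude bound for y in [0, 1]; the constant 32 is 6·4 + 8.
  have k1 : |3 * y * (1 - y) - y ^ 2| ≤ 4 := by rw [abs_le]; constructor <;> nlinarith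
  refine (abs_add_le _ _).trans ?_
  rw [abs_mul, abs_mul (8 * ε ^ 2), abs_of_nonneg (by positivity : 0 ≤ 6 * ε),
    abs_of_nonneg (by positivity : 0 ≤ 8 * ε ^ 2)]
  nlinarith [abs_sin_pow_mul_cos_le 7 x, abs_nonneg (Real.sin x ^ 7 * Real.cos x), sq_nonneg ε]

theorem growth_monotone : Monotone growth :=
  monotone_of_deriv_nonneg (fun x => (hasDerivAt_growth x).differentiableAt)
    fun x => by rw [(hasDerivAt_growth x).deriv]; positivity

theorem growth_zero : growth 0 = 0 := by simp [growth]

theorem growth_nat_mul_pi (n : ℕ) : growth (n * Real.pi) = 3 / 8 * (n * Real.pi) := by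
  simp [growth, Real.sin_nat_mul_pi]

/-- The resonant solution, in the time scale of the oscillation. -/
noncomputable def resonantSol (ε x : ℝ) : ℝ := Real.sin x * Real.exp (ε * growth x)

/-- The derivative of `resonantSol ε`. -/
noncomputable def resonantSolDeriv (ε x : ℝ) : ℝ :=
  (Real.cos x + ε * Real.sin x ^ 5) * Real.exp (ε * growth x)

theorem hasDerivAt_resonantSol (ε x : ℝ) :
    HasDerivAt (resonantSol ε) (resonantSolDeriv ε x) x := by
  have := (Real.hasDerivAt_sin x).mul (((hasDerivAt_growth x).const_mul ε).exp)
  convert! this using 1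
  rw [resonantSolDeriv]; ring

theorem hasDerivAt_resonantSolDeriv (ε x : ℝ) :
    HasDerivAt (resonantSolDeriv ε) (-((1 - resonance ε x) * resonantSol ε x)) x := by
  have hs := Real.hasDerivAt_sin x
  have := ((Real.hasDerivAt_cos x).add ((hs.pow 5).const_mul ε)).mul
    (((hasDerivAt_growth x).const_mul ε).exp)
  convert! this using 1
  simp only [resonance, resonantSol, Nat.cast_ofNat, Pi.add_apply, Pi.pow_apply]
  ring

end Kirchhoff

namespace Kirchhoff

/-! ### The oscillating coefficient -/

/-- The factor sin³ makes the profile vanish together with its derivative at multiples of π, so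
freezing it outside [0, Nπ] creates no corner. This is the reason for a growth rate sin⁴ in place of
sin², which would give only a simple zero. -/
theorem differentiable_resonance_clip (ε : ℝ) (N : ℕ) :
    Differentiable ℝ (fun y => resonance ε (clip 0 (N * Real.pi) y)) := by
  have hL : 0 ≤ N * Real.pi := by positivity
  set L := N * Real.pi with hLdef
  have sL : Real.sin L = 0 := Real.sin_nat_mul_pi N
  have r0 : resonance ε 0 = 0 := by simp [resonance]
  have rL : resonance ε L = 0 := by simp [resonance, sL]
  have endpoint (y₀ : ℝ) (hs : Real.sin y₀ = 0) (hy : resonance ε (clip 0 L y₀) = 0) :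
      DifferentiableAt ℝ (fun y => resonance ε (clip 0 L y)) y₀ := by
    have h := hasDerivAt_resonance ε y₀
    rw [show resonanceDeriv ε y₀ = 0 by simp [resonanceDeriv, hs]] at h
    have ry : resonance ε y₀ = 0 := by simp [resonance, hs]
    refine HasDerivAt.differentiableAt (f' := 0) ?_
    rw [hasDerivAt_iff_isLittleO] at h ⊢
    -- The clipped profile is either the profile itself or 0, so it is dominated by the profile,
    -- which is o(y - y₀).
    refine Asymptotics.IsBigO.trans_isLittleO (Asymptotics.isBigO_of_le _ fun y => ?_) h
    simp only [hy, ry, smul_zero, sub_zero]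
    rcases le_total y 0 with h0 | h0
    · rw [clip_of_le h0, r0]; simp
    rcases le_total y L with h1 | h1
    · rw [clip_of_mem ⟨h0, h1⟩]
    · rw [clip_of_ge hL h1, rL]; simp
  intro y
  rcases lt_trichotomy y 0 with h0 | h0 | h0
  · refine (differentiableAt_const (0 : ℝ)).congr_of_eventuallyEq ?_
    filter_upwards [Iio_mem_nhds h0] with z hz
    rw [clip_of_le hz.le, r0]
  · subst h0
    exact endpoint 0 Real.sin_zero (by rw [clip_of_le le_rfl, r0])
  rcases lt_trichotomy y L with h1 | h1 | h1
  · refine (hasDerivAt_resonance ε y).differentiableAt.congr_of_eventuallyEq ?_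
    filter_upwards [Ioo_mem_nhds h0 h1] with z hz
    rw [clip_of_mem (Ioo_subset_Icc_self hz)]
  · subst h1
    exact endpoint _ sL (by rw [clip_of_ge hL le_rfl, rL])
  · refine (differentiableAt_const (0 : ℝ)).congr_of_eventuallyEq ?_
    filter_upwards [Ioi_mem_nhds h1] with z hz
    rw [clip_of_ge hL (le_of_lt hz), rL]

theorem abs_resonance_sub_le {ε : ℝ} (h0 : 0 ≤ ε) (h1 : ε ≤ 1) (x y : ℝ) :
    |resonance ε x - resonance ε y| ≤ 32 * ε * |x - y| := by
  have := convex_univ.norm_image_sub_le_of_norm_hasDerivWithin_le (f := resonance ε)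
    (f' := resonanceDeriv ε) (C := 32 * ε) (x := y) (y := x)
    (fun z _ => (hasDerivAt_resonance ε z).hasDerivWithinAt)
    (fun z _ => abs_resonanceDeriv_le h0 h1 z) (mem_univ _) (mem_univ _)
  simpa using this

/-- The number of half periods of the `n`-th burst of oscillations. -/
noncomputable def burstCount (μ : ℕ → ℝ) (n : ℕ) : ℕ := ⌊μ n * (1 / 2) ^ n / 4⌋₊

/-- The `n`-th burst of oscillations, of frequency `μ n` and amplitude `ε n`, carried by the
interval `[2⁻ⁿ, 2⁻ⁿ + π * burstCount μ n / μ n]`. -/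
noncomputable def burst (μ ε : ℕ → ℝ) (n : ℕ) (t : ℝ) : ℝ :=
  resonance (ε n) (clip 0 (burstCount μ n * Real.pi) (μ n * (t - (1 / 2) ^ n)))

/-- The oscillating coefficient. -/
noncomputable def coeff (μ ε : ℕ → ℝ) (t : ℝ) : ℝ := 1 - ∑' n, burst μ ε n t

/-- The end of the `n`-th burst. -/
noncomputable def burstEnd (μ : ℕ → ℝ) (n : ℕ) : ℝ := (1 / 2) ^ n + burstCount μ n * Real.pi / μ n

/-- Frequencies and amplitudes for which `coeff μ ε` produces a derivative loss. -/
structure IsResonantSeq (φ : ℝ → ℝ) (μ ε : ℕ → ℝ) : Prop where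
  mu_pos : ∀ n, 0 < μ n
  eps_nonneg : ∀ n, 0 ≤ ε n
  eps_zero : ε 0 = 0
  -- A burst is at most 7 ε n in size, so this keeps the coefficient in [1/2, 3/2].
  eps_le : ∀ n, ε n ≤ 1 / 14
  small : ∀ m n, m < n → μ m * ε n ≤ 1
  large : ∀ n, 0 < n → 8 * 2 ^ n ≤ μ n
  gain : ∀ n, 0 < n → 8 * 2 ^ n * (n * φ (μ n)) ≤ μ n * ε n
  gap : ∀ n, 0 < n → Real.exp (n * (n + ∑ m ∈ Finset.range n, μ m * ε m)) ≤ μ n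

variable {φ : ℝ → ℝ} {μ ε : ℕ → ℝ}

theorem half_pow_le_of_lt {m n : ℕ} (h : m < n) : 2 * (1 / 2 : ℝ) ^ n ≤ (1 / 2) ^ m := by
  calc 2 * (1 / 2 : ℝ) ^ n ≤ 2 * (1 / 2) ^ (m + 1) := by
        gcongr 2 * ?_
        exact pow_le_pow_of_le_one (by norm_num) (by norm_num) h
    _ = _ := by rw [pow_succ]; ring

namespace IsResonantSeq

/-- The divisor 4 in the count exceeds π, so the burst fits in its dyadic interval. -/
theorem burstCount_mul_pi_le (h : IsResonantSeq φ μ ε) (n : ℕ) :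
    burstCount μ n * Real.pi ≤ μ n * (1 / 2) ^ n := by
  have h0 := h.mu_pos n
  have h1 : (burstCount μ n : ℝ) ≤ μ n * (1 / 2) ^ n / 4 := Nat.floor_le (by positivity)
  have := Real.pi_le_four
  have : (0 : ℝ) ≤ burstCount μ n := Nat.cast_nonneg _
  have : 0 ≤ μ n * (1 / 2) ^ n := by positivity
  nlinarith [Real.pi_pos]

/-- By `large` the argument of the floor is at least 2, so rounding loses at most half of it. -/
theorem le_burstCount (h : IsResonantSeq φ μ ε) {n : ℕ} (hn : 0 < n) :
    μ n * (1 / 2) ^ n / 8 ≤ burstCount μ n := by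
  have h1 : μ n * (1 / 2) ^ n / 4 < burstCount μ n + 1 := Nat.lt_floor_add_one _
  have h2 : 8 ≤ μ n * (1 / 2) ^ n := by
    have := h.large n hn
    calc (8 : ℝ) = 8 * 2 ^ n * (1 / 2) ^ n := by
          rw [mul_assoc, ← mul_pow]; norm_num
      _ ≤ _ := by gcongr
  linarith

theorem le_burstEnd (h : IsResonantSeq φ μ ε) (n : ℕ) : (1 / 2) ^ n ≤ burstEnd μ n := by
  have := h.mu_pos n
  rw [burstEnd, le_add_iff_nonneg_right]
  positivity

theorem burstEnd_le (h : IsResonantSeq φ μ ε) (n : ℕ) : burstEnd μ n ≤ 2 * (1 / 2) ^ n := by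
  rw [burstEnd, two_mul]
  gcongr
  rw [div_le_iff₀ (h.mu_pos n)]
  exact (h.burstCount_mul_pi_le n).trans_eq (mul_comm _ _)

theorem burst_eq_zero_of_le (h : IsResonantSeq φ μ ε) {n : ℕ} {t : ℝ} (ht : t ≤ (1 / 2) ^ n) :
    burst μ ε n t = 0 := by
  rw [burst, clip_of_le]
  · simp [resonance]
  · exact mul_nonpos_of_nonneg_of_nonpos (h.mu_pos n).le (by linarith)

theorem burst_eq_zero_of_burstEnd_le (h : IsResonantSeq φ μ ε) {n : ℕ} {t : ℝ}
    (ht : burstEnd μ n ≤ t) : burst μ ε n t = 0 := by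
  rw [burst, clip_of_ge (by positivity)]
  · simp [resonance, Real.sin_nat_mul_pi]
  · rw [burstEnd] at ht
    have := h.mu_pos n
    rw [← div_le_iff₀' this]
    linarith

theorem burst_eq_zero_of_ge (h : IsResonantSeq φ μ ε) {n : ℕ} {t : ℝ}
    (ht : 2 * (1 / 2) ^ n ≤ t) : burst μ ε n t = 0 :=
  h.burst_eq_zero_of_burstEnd_le ((h.burstEnd_le n).trans ht)

theorem burst_eq_zero_of_ne (h : IsResonantSeq φ μ ε) {n m : ℕ} (hm : m ≠ n) {t : ℝ}
    (ht : t ∈ Icc ((1 / 2) ^ n) (2 * (1 / 2) ^ n)) : burst μ ε m t = 0 := by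
  rcases lt_or_gt_of_ne hm with hlt | hlt
  · exact h.burst_eq_zero_of_le (ht.2.trans (half_pow_le_of_lt hlt))
  · exact h.burst_eq_zero_of_ge ((half_pow_le_of_lt hlt).trans ht.1)

/-- Consecutive dyadic intervals meet only at endpoints, where bursts vanish. Thus the series
defining `coeff` has at most one nonzero term at each time, and estimates for it reduce to a single
burst. -/
theorem exists_burst_eq_zero_of_ne (h : IsResonantSeq φ μ ε) (t : ℝ) :
    ∃ n, ∀ m, m ≠ n → burst μ ε m t = 0 := by
  by_cases H : ∃ n, t ∈ Icc ((1 / 2) ^ n) (2 * (1 / 2) ^ n)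
  · obtain ⟨n, hn⟩ := H
    exact ⟨n, fun m hm => h.burst_eq_zero_of_ne hm hn⟩
  · refine ⟨0, fun m _ => ?_⟩
    by_contra hne
    refine H ⟨m, ?_, ?_⟩
    · by_contra hlt
      exact hne (h.burst_eq_zero_of_le (not_le.1 hlt).le)
    · by_contra hlt
      exact hne (h.burst_eq_zero_of_ge (not_le.1 hlt).le)

theorem abs_burst_le (h : IsResonantSeq φ μ ε) (n : ℕ) (t : ℝ) :
    |burst μ ε n t| ≤ 7 * ε n :=
  abs_resonance_le (h.eps_nonneg n) (by linarith [h.eps_le n]) _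

theorem abs_burst_sub_le (h : IsResonantSeq φ μ ε) (n : ℕ) (s t : ℝ) :
    |burst μ ε n s - burst μ ε n t| ≤ 32 * (μ n * ε n) * |s - t| := by
  refine (abs_resonance_sub_le (h.eps_nonneg n) (by linarith [h.eps_le n]) _ _).trans ?_
  have h1 := abs_clip_sub_clip_le 0 (burstCount μ n * Real.pi) (μ n * (s - (1 / 2) ^ n))
    (μ n * (t - (1 / 2) ^ n))
  have h2 : μ n * (s - (1 / 2) ^ n) - μ n * (t - (1 / 2) ^ n) = μ n * (s - t) := by ring
  rw [h2, abs_mul, abs_of_pos (h.mu_pos n)] at h1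
  calc _ ≤ 32 * ε n * (μ n * |s - t|) := by
        have := h.eps_nonneg n
        gcongr
    _ = _ := by ring

theorem differentiable_burst (μ ε : ℕ → ℝ) (n : ℕ) : Differentiable ℝ (burst μ ε n) :=
  (differentiable_resonance_clip (ε n) (burstCount μ n)).comp (by fun_prop)

theorem abs_deriv_burst_le (h : IsResonantSeq φ μ ε) (n : ℕ) (t : ℝ) :
    |deriv (burst μ ε n) t| ≤ 32 * (μ n * ε n) := by
  have hC : 0 ≤ 32 * (μ n * ε n) :=
    mul_nonneg (by norm_num) (mul_nonneg (h.mu_pos n).le (h.eps_nonneg n))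
  exact norm_deriv_le_of_lipschitz (f := burst μ ε n) (C := ⟨_, hC⟩)
    (LipschitzWith.of_dist_le_mul fun s t => h.abs_burst_sub_le n s t)

theorem coeff_eq (t : ℝ) {n : ℕ} (hn : ∀ m, m ≠ n → burst μ ε m t = 0) :
    coeff μ ε t = 1 - burst μ ε n t := by
  rw [coeff, tsum_eq_single n hn]

theorem abs_one_sub_coeff_le (h : IsResonantSeq φ μ ε) (t : ℝ) : |1 - coeff μ ε t| ≤ 1 / 2 := by
  obtain ⟨n, hn⟩ := h.exists_burst_eq_zero_of_ne t
  rw [coeff_eq t hn, sub_sub_cancel]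
  linarith [h.abs_burst_le n t, h.eps_le n]

theorem coeff_mem (h : IsResonantSeq φ μ ε) (t : ℝ) :
    coeff μ ε t ∈ Icc (1 / 2 : ℝ) (3 / 2) := by
  have := abs_le.1 (h.abs_one_sub_coeff_le t)
  constructor <;> linarith

/-- Before the `n`-th burst the coefficient is close to `1`. -/
theorem mul_abs_one_sub_coeff_le (h : IsResonantSeq φ μ ε) {n : ℕ} {t : ℝ}
    (ht : t ≤ (1 / 2) ^ n) : μ n * |1 - coeff μ ε t| ≤ 7 := by
  obtain ⟨m, hm⟩ := h.exists_burst_eq_zero_of_ne t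
  rw [coeff_eq t hm, sub_sub_cancel]
  rcases le_or_gt m n with hmn | hmn
  · rw [h.burst_eq_zero_of_le (ht.trans (pow_le_pow_of_le_one (by norm_num) (by norm_num) hmn))]
    simp
  -- The active burst is a faster one, whose amplitude was chosen below 1 / μ n.
  · have := h.small n m hmn
    have := mul_le_mul_of_nonneg_left (h.abs_burst_le m t) (h.mu_pos n).le
    linarith

theorem coeff_eq_of_mem (h : IsResonantSeq φ μ ε) {n : ℕ} {t : ℝ}
    (ht : t ∈ Icc ((1 / 2) ^ n) (burstEnd μ n)) :
    coeff μ ε t = 1 - resonance (ε n) (μ n * (t - (1 / 2) ^ n)) := by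
  rw [coeff_eq t (n := n) fun m hm =>
    h.burst_eq_zero_of_ne hm ⟨ht.1, ht.2.trans (h.burstEnd_le n)⟩, burst, clip_of_mem]
  have := h.mu_pos n
  refine ⟨mul_nonneg this.le (by linarith [ht.1]), ?_⟩
  rw [← le_div_iff₀' this]
  have := ht.2
  rw [burstEnd] at this
  linarith

theorem coeff_eq_of_burstEnd_le (h : IsResonantSeq φ μ ε) {n : ℕ} {t : ℝ}
    (ht : burstEnd μ n ≤ t) :
    coeff μ ε t = 1 - ∑ m ∈ Finset.range n, burst μ ε m t := by
  rw [coeff, tsum_eq_sum]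
  intro m hm
  rw [Finset.mem_range, not_lt] at hm
  rcases hm.eq_or_lt with rfl | hm
  · exact h.burst_eq_zero_of_burstEnd_le ht
  · exact h.burst_eq_zero_of_ge ((half_pow_le_of_lt hm).trans ((h.le_burstEnd n).trans ht))

/-- The modulus of continuity of the coefficient. -/
theorem abs_coeff_sub_le (h : IsResonantSeq φ μ ε) {ω : ℝ → ℝ}
    (hω : ∀ n x, 0 ≤ x → ε n * min 1 (μ n * x) ≤ ω x) (s t : ℝ) :
    |coeff μ ε s - coeff μ ε t| ≤ 64 * ω |s - t| := by
  have key (n : ℕ) : |burst μ ε n s - burst μ ε n t| ≤ 32 * ω |s - t| := by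
    refine le_trans ?_ (mul_le_mul_of_nonneg_left (hω n _ (abs_nonneg (s - t))) (by norm_num))
    rcases le_total 1 (μ n * |s - t|) with h1 | h1
    · rw [min_eq_left h1]
      have := abs_sub (burst μ ε n s) (burst μ ε n t)
      linarith [h.abs_burst_le n s, h.abs_burst_le n t, h.eps_nonneg n]
    · rw [min_eq_right h1]
      exact (h.abs_burst_sub_le n s t).trans_eq (by ring)
  obtain ⟨n, hn⟩ := h.exists_burst_eq_zero_of_ne s
  obtain ⟨m, hm⟩ := h.exists_burst_eq_zero_of_ne t
  rw [coeff_eq s hn, coeff_eq t hm]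
  by_cases hnm : n = m
  · subst hnm
    have e : 1 - burst μ ε n s - (1 - burst μ ε n t) = -(burst μ ε n s - burst μ ε n t) := by ring
    rw [e, abs_neg]
    linarith [key n, abs_nonneg (burst μ ε n s - burst μ ε n t)]
  -- Each of the two active bursts vanishes at the other time, so both values are increments of one
  -- burst; this doubles 32 to 64.
  · have k1 := key n
    have k2 := key m
    rw [hm n hnm] at k1
    rw [hn m (Ne.symm hnm)] at k2
    have e : 1 - burst μ ε n s - (1 - burst μ ε m t)
        = -((burst μ ε n s - 0) + (0 - burst μ ε m t)) := by ring
    rw [e, abs_neg]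
    linarith [abs_add_le (burst μ ε n s - 0) (0 - burst μ ε m t)]

/-! ### The resonant modes -/

/-- Uniqueness for the linear equation: the difference from the explicit solution is an oscillator
with zero energy at the start of the burst, and the energy estimate keeps it zero. -/
theorem eq_resonantSol (h : IsResonantSeq φ μ ε) {n : ℕ} {w v : ℝ → ℝ} {β : ℝ}
    (hwv : IsOscillator (coeff μ ε) (μ n) (Icc ((1 / 2) ^ n) (burstEnd μ n)) w v)
    (hw0 : w ((1 / 2) ^ n) = 0) (hv0 : v ((1 / 2) ^ n) = β) {t : ℝ}
    (ht : t ∈ Icc ((1 / 2) ^ n) (burstEnd μ n)) :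
    μ n * w t = β * resonantSol (ε n) (μ n * (t - (1 / 2) ^ n)) ∧
      v t = β * resonantSolDeriv (ε n) (μ n * (t - (1 / 2) ^ n)) := by
  have hμ := h.mu_pos n
  set a : ℝ := (1 / 2) ^ n
  have hphase (s : ℝ) : HasDerivAt (fun s => μ n * (s - a)) (μ n) s := by
    simpa using ((hasDerivAt_id s).sub_const a).const_mul (μ n)
  have hd : IsOscillator (coeff μ ε) (μ n) (Icc a (burstEnd μ n))
      (fun s => w s - β / μ n * resonantSol (ε n) (μ n * (s - a)))
      (fun s => v s - β * resonantSolDeriv (ε n) (μ n * (s - a))) := by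
    intro s hs
    have e1 := ((hasDerivAt_resonantSol (ε n) _).comp s (hphase s)).const_mul (β / μ n)
    have e2 := ((hasDerivAt_resonantSolDeriv (ε n) _).comp s (hphase s)).const_mul β
    refine ⟨?_, ?_⟩
    · convert! (hwv s hs).1.sub e1 using 1
      field_simp
    · convert! (hwv s hs).2.sub e2 using 1
      rw [h.coeff_eq_of_mem hs]
      field_simp
      ring
  have := hd.energy_le hμ (convex_Icc _ _) (K := μ n * (1 / 2))
    (fun s _ => mul_le_mul_of_nonneg_left (h.abs_one_sub_coeff_le s) hμ.le)
    (s := a) ⟨le_rfl, h.le_burstEnd n⟩ ht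
  simp only [hw0, hv0, sub_self, mul_zero, resonantSol, resonantSolDeriv, growth_zero,
    Real.sin_zero, Real.cos_zero, Real.exp_zero, ne_eq, OfNat.ofNat_ne_zero, not_false_eq_true,
    zero_pow, mul_one, add_zero, zero_mul] at this
  have k1 := sq_nonneg (v t - β * resonantSolDeriv (ε n) (μ n * (t - a)))
  have k2 := mul_nonneg (sq_nonneg (μ n))
    (sq_nonneg (w t - β / μ n * resonantSol (ε n) (μ n * (t - a))))
  constructor
  · have : (μ n) ^ 2 * (w t - β / μ n * resonantSol (ε n) (μ n * (t - a))) ^ 2 = 0 := by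
      simp only [resonantSol, resonantSolDeriv] at k1 k2 ⊢; linarith
    have : w t - β / μ n * resonantSol (ε n) (μ n * (t - a)) = 0 := by
      simpa [hμ.ne'] using this
    rw [sub_eq_zero.1 this]; field_simp
  · have : (v t - β * resonantSolDeriv (ε n) (μ n * (t - a))) ^ 2 = 0 := by
      simp only [resonantSol, resonantSolDeriv] at k1 k2 ⊢; linarith
    exact sub_eq_zero.1 (pow_eq_zero_iff (two_ne_zero) |>.1 this)

end IsResonantSeq

theorem resonantSol_energy_le {ε : ℝ} (h0 : 0 ≤ ε) (h1 : ε ≤ 1 / 14) (x : ℝ) :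
    resonantSol ε x ^ 2 + resonantSolDeriv ε x ^ 2 ≤ 3 * Real.exp (2 * (ε * growth x)) := by
  have e : Real.exp (2 * (ε * growth x)) = Real.exp (ε * growth x) ^ 2 := by
    rw [← Real.exp_nat_mul]; norm_num
  rw [resonantSol, resonantSolDeriv, e, mul_pow, mul_pow, ← add_mul]
  gcongr
  have s5 := abs_le.1 (abs_pow (Real.sin x) 5 ▸
    pow_le_one₀ (n := 5) (abs_nonneg _) (Real.abs_sin_le_one x))
  have hc := abs_le.1 (Real.abs_cos_le_one x)
  have hy : |Real.cos x + ε * Real.sin x ^ 5| ≤ 15 / 14 := by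
    rw [abs_le]; constructor <;> nlinarith
  have := sq_le_sq' (by linarith [(abs_le.1 hy).1]) (abs_le.1 hy).2
  nlinarith [Real.sin_sq_le_one x]

end Kirchhoff

namespace Kirchhoff

/-! ### Size of a mode before, during and after its burst. -/

variable {φ : ℝ → ℝ} {μ ε : ℕ → ℝ}

/-- The total oscillation of the bursts following the `n`-th one, increased by `n`. -/
noncomputable def lossRate (μ ε : ℕ → ℝ) (n : ℕ) : ℝ := n + ∑ m ∈ Finset.range n, μ m * ε m

theorem IsResonantSeq.le_lossRate (h : IsResonantSeq φ μ ε) (n : ℕ) : n ≤ lossRate μ ε n := by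
  rw [lossRate, le_add_iff_nonneg_right]
  exact Finset.sum_nonneg fun m _ => mul_nonneg (h.mu_pos m).le (h.eps_nonneg m)

/-- After the `n`-th burst the hyperbolic energy changes at most by a factor that depends
on the later, slower, bursts. -/
theorem IsResonantSeq.hyperbolic_energy_le (h : IsResonantSeq φ μ ε) {n : ℕ} {ν : ℝ}
    {w v : ℝ → ℝ} (hwv : IsOscillator (coeff μ ε) ν (Ico (burstEnd μ n) 2) w v)
    {s t : ℝ} (hs : s ∈ Ico (burstEnd μ n) 2) (ht : t ∈ Ico (burstEnd μ n) 2) :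
    v t ^ 2 + ν ^ 2 * (coeff μ ε t * w t ^ 2)
      ≤ (v s ^ 2 + ν ^ 2 * (coeff μ ε s * w s ^ 2))
        * Real.exp (128 * ∑ m ∈ Finset.range n, μ m * ε m) := by
  have heq (t : ℝ) (ht : t ∈ Ico (burstEnd μ n) 2) := h.coeff_eq_of_burstEnd_le (ht.1)
  have hd (t : ℝ) : HasDerivAt (fun t => 1 - ∑ m ∈ Finset.range n, burst μ ε m t)
      (-∑ m ∈ Finset.range n, deriv (burst μ ε m) t) t :=
    (HasDerivAt.fun_sum fun m _ =>
      (differentiable_burst μ ε m t).hasDerivAt).const_sub 1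
  have hS : 0 ≤ ∑ m ∈ Finset.range n, μ m * ε m :=
    Finset.sum_nonneg fun m _ => mul_nonneg (h.mu_pos m).le (h.eps_nonneg m)
  have := IsOscillator.hyperbolic_energy_le (c := fun t => 1 - ∑ m ∈ Finset.range n, burst μ ε m t)
    (D := 32 * ∑ m ∈ Finset.range n, μ m * ε m) (I := Ico (burstEnd μ n) 2) (μ := ν)
    (w := w) (v := v) (fun t ht => by have := hwv t ht; rwa [heq t ht] at this) (convex_Ico _ _)
    (fun t _ => (hd t).continuousAt.continuousWithinAt) (fun t _ => hd t)
    (fun t _ => by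
      rw [abs_neg, Finset.mul_sum]
      exact (Finset.abs_sum_le_sum_abs _ _).trans
        (Finset.sum_le_sum fun m _ => h.abs_deriv_burst_le m t))
    (fun t ht => by rw [← heq t ht]; exact (h.coeff_mem t).1) hs ht
  rw [heq t ht, heq s hs]
  refine this.trans ?_
  have hc := (h.coeff_mem s).1
  rw [heq s hs] at hc
  have hE : 0 ≤ v s ^ 2 + ν ^ 2 * ((1 - ∑ m ∈ Finset.range n, burst μ ε m s) * w s ^ 2) := by
    have : 0 ≤ 1 - ∑ m ∈ Finset.range n, burst μ ε m s := by linarith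
    positivity
  refine mul_le_mul_of_nonneg_left (Real.exp_le_exp.2 ?_) hE
  -- The exponent 128 is 2·32·2: twice the bound for the derivative of the coefficient, times the
  -- length of time.
  have : |t - s| ≤ 2 := by
    have h0 : 0 ≤ burstEnd μ n := (by positivity : (0 : ℝ) ≤ (1 / 2) ^ n).trans (h.le_burstEnd n)
    rw [abs_le]; constructor <;> linarith [hs.1, hs.2, ht.1, ht.2]
  nlinarith

/-- Over a whole number of half periods `growth` is 3/8 of the phase, and 3π/8 > 1. The factor 8·2ⁿ
in `gain` compensates the lower bound μ n 2⁻ⁿ / 8 for the number of half periods. -/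
theorem IsResonantSeq.le_gain (h : IsResonantSeq φ μ ε) {n : ℕ} (hn : 0 < n) :
    2 * (n * φ (μ n)) ≤ 2 * (ε n * growth (burstCount μ n * Real.pi)) := by
  have h1 := h.gain n hn
  have h2 := h.le_burstCount hn
  rw [growth_nat_mul_pi]
  have h3 : n * φ (μ n) ≤ μ n * (1 / 2) ^ n / 8 * ε n := by
    have : 8 * 2 ^ n * (n * φ (μ n)) * ((1 / 2) ^ n / 8) = n * φ (μ n) := by
      have : (2 : ℝ) ^ n * (1 / 2) ^ n = 1 := by rw [← mul_pow]; norm_num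
      linear_combination (n * φ (μ n)) * this
    rw [← this]
    calc _ ≤ μ n * ε n * ((1 / 2) ^ n / 8) := by gcongr
      _ = _ := by ring
  have h4 := mul_le_mul_of_nonneg_right h2 (h.eps_nonneg n)
  have h5 : 0 ≤ burstCount μ n * ε n := mul_nonneg (Nat.cast_nonneg _) (h.eps_nonneg n)
  nlinarith [Real.pi_gt_three]

set_option maxHeartbeats 800000 in
/-- The `n`-th mode: it is very small at the initial time, and large after the `n`-th burst. -/
theorem IsResonantSeq.exists_mode (h : IsResonantSeq φ μ ε) (hc : Continuous (coeff μ ε)) {n : ℕ}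
    (hn : 0 < n) : ∃ w v : ℝ → ℝ, IsOscillator (coeff μ ε) (μ n) (Ioo (-1) 2) w v ∧
      (∀ t ∈ Ioo (-1 : ℝ) 2, μ n * (v t ^ 2 + μ n ^ 2 * w t ^ 2) ≤ Real.exp (14 - 2 * n)) ∧
      μ n * (v 0 ^ 2 + μ n ^ 2 * w 0 ^ 2) ≤ Real.exp (14 - 2 * n - 2 * (n * φ (μ n))) ∧
      ∀ t ∈ Ico (2 * (1 / 2) ^ n) (2 : ℝ),
        Real.exp (-300 * lossRate μ ε n) ≤ μ n * (v t ^ 2 + μ n ^ 2 * w t ^ 2) := by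
  have hμ := h.mu_pos n
  have ha1 : (1 / 2 : ℝ) ^ n ≤ 1 / 2 := by
    simpa using pow_le_pow_of_le_one (by norm_num : (0:ℝ) ≤ 1/2) (by norm_num) hn
  have ha0 : (0 : ℝ) < (1 / 2) ^ n := by positivity
  have hab := h.le_burstEnd n
  have hbe := h.burstEnd_le n
  set a : ℝ := (1 / 2) ^ n with hadef
  set b := burstEnd μ n with hbdef
  set S := lossRate μ ε n
  set P := ∑ m ∈ Finset.range n, μ m * ε m
  have hSn : (n : ℝ) ≤ S := h.le_lossRate n
  have hSP : S = n + P := rfl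
  have hn1 : (1 : ℝ) ≤ n := by exact_mod_cast hn
  have hP0 : 0 ≤ P := by linarith
  set G := 2 * (ε n * growth (burstCount μ n * Real.pi)) with hG
  have hGφ := h.le_gain hn
  -- Normalized so that the gain `G` brings the energy to exp(-130 S) at the end of the burst. As
  -- 130 ≥ 128 + 2, the bound exp(-2n) survives the later factor exp(128 P).
  set β := Real.sqrt (Real.exp (-130 * S - G) / μ n) with hβ
  have hβ2 : μ n * β ^ 2 = Real.exp (-130 * S - G) := by
    rw [hβ, Real.sq_sqrt (by positivity)]; field_simp
  -- The data are imposed at the start of the burst, in phase with the resonant profile, and the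
  -- solution is followed in both time directions.
  obtain ⟨w, v, hw0, hv0, hwv⟩ := exists_isOscillator hc
    (fun t => abs_le.2 ⟨by linarith [(h.coeff_mem t).1], by linarith [(h.coeff_mem t).2]⟩) (μ n)
    (t₀ := a) ⟨by linarith, by linarith⟩ 0 β
  have sub {I : Set ℝ} (hI : I ⊆ Ioo (-1) 2) : IsOscillator (coeff μ ε) (μ n) I w v :=
    fun t ht => hwv t (hI ht)
  have early (t : ℝ) (ht : t ∈ Ioc (-1) a) :
      μ n * (v t ^ 2 + μ n ^ 2 * w t ^ 2) ≤ Real.exp (14 - 130 * S - G) := by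
    have := (sub (I := Ioc (-1) a) fun t ht => ⟨ht.1, by linarith [ht.2]⟩).energy_le hμ
      (convex_Ioc _ _) (K := 7) (fun t ht => h.mul_abs_one_sub_coeff_le ht.2) (s := a)
      ⟨by linarith, le_rfl⟩ ht
    rw [hw0, hv0] at this
    -- The exponent 14 comes from rate 7 over a time less than 2.
    have habs : 7 * |t - a| ≤ 14 := by
      rw [abs_of_nonpos (by linarith [ht.2])]; linarith [ht.1]
    calc _ ≤ μ n * ((β ^ 2 + μ n ^ 2 * 0 ^ 2) * Real.exp (7 * |t - a|)) := by gcongr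
      _ = Real.exp (-130 * S - G) * Real.exp (7 * |t - a|) := by rw [← hβ2]; ring
      _ ≤ Real.exp (-130 * S - G) * Real.exp 14 := by gcongr
      _ = _ := by rw [← Real.exp_add]; ring_nf
  have hsol (t : ℝ) (ht : t ∈ Icc a b) := h.eq_resonantSol
    (sub (I := Icc a b) fun t ht => ⟨by linarith [ht.1], by linarith [ht.2, hbe]⟩) hw0 hv0 ht
  have middle (t : ℝ) (ht : t ∈ Icc a b) :
      μ n * (v t ^ 2 + μ n ^ 2 * w t ^ 2) ≤ 3 * Real.exp (-130 * S) := by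
    obtain ⟨e1, e2⟩ := hsol t ht
    rw [← mul_pow, e1, e2]
    set x := μ n * (t - a)
    have hx : growth x ≤ growth (burstCount μ n * Real.pi) := by
      refine growth_monotone ?_
      rw [← le_div_iff₀' hμ]
      have := ht.2
      rw [hbdef, burstEnd] at this
      linarith
    have h0 := h.eps_nonneg n
    calc _ = μ n * β ^ 2 * (resonantSol (ε n) x ^ 2 + resonantSolDeriv (ε n) x ^ 2) := by ring
      _ ≤ Real.exp (-130 * S - G) * (3 * Real.exp (2 * (ε n * growth x))) := by
          rw [hβ2]
          gcongr
          exact resonantSol_energy_le h0 (h.eps_le n) x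
      _ ≤ Real.exp (-130 * S - G) * (3 * Real.exp G) := by
          rw [hG]; gcongr
      _ = _ := by rw [mul_left_comm, ← Real.exp_add]; ring_nf
  -- The burst ends at a zero of the sine, so the energy there is purely kinetic and does not
  -- involve the coefficient.
  have hwb : w b = 0 ∧ μ n * v b ^ 2 = Real.exp (-130 * S) := by
    obtain ⟨e1, e2⟩ := hsol b ⟨hab, le_rfl⟩
    have hx : μ n * (b - a) = burstCount μ n * Real.pi := by
      rw [hbdef, burstEnd]; field_simp; ring
    have hs : Real.sin (burstCount μ n * Real.pi) = 0 := Real.sin_nat_mul_pi _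
    have hcos : Real.cos (burstCount μ n * Real.pi) ^ 2 = 1 := by
      rw [Real.cos_sq', hs]; norm_num
    rw [hx, resonantSol, hs, zero_mul, mul_zero] at e1
    rw [hx, resonantSolDeriv, hs] at e2
    refine ⟨by simpa [hμ.ne'] using e1, ?_⟩
    have e : Real.exp (ε n * growth (burstCount μ n * Real.pi)) ^ 2 = Real.exp G := by
      rw [hG, ← Real.exp_nat_mul]; norm_num
    calc μ n * v b ^ 2 = (μ n * β ^ 2) * (Real.cos (burstCount μ n * Real.pi) ^ 2
          * Real.exp (ε n * growth (burstCount μ n * Real.pi)) ^ 2) := by rw [e2]; ring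
      _ = _ := by rw [hβ2, hcos, e, one_mul, ← Real.exp_add]; ring_nf
  have hb2 : b < 2 := by linarith
  have late (t : ℝ) (ht : t ∈ Ico b 2) :
      μ n * (v t ^ 2 + μ n ^ 2 * w t ^ 2) ≤ 2 * Real.exp (128 * P - 130 * S) ∧
      2 / 3 * Real.exp (-130 * S - 128 * P) ≤ μ n * (v t ^ 2 + μ n ^ 2 * w t ^ 2) := by
    have hsub := sub (I := Ico b 2) fun t ht => ⟨by linarith [ht.1], ht.2⟩
    have u1 := h.hyperbolic_energy_le hsub (s := b) ⟨le_rfl, hb2⟩ ht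
    have u2 := h.hyperbolic_energy_le hsub ht (t := b) ⟨le_rfl, hb2⟩
    rw [hwb.1] at u1 u2
    have c1 := h.coeff_mem t
    set E := v t ^ 2 + μ n ^ 2 * (coeff μ ε t * w t ^ 2) with hE
    have q : 0 ≤ μ n ^ 2 * w t ^ 2 := by positivity
    have E1 : v t ^ 2 + μ n ^ 2 * w t ^ 2 ≤ 2 * E := by
      nlinarith [sq_nonneg (v t), mul_nonneg q (sub_nonneg.2 c1.1)]
    have E2 : E ≤ 3 / 2 * (v t ^ 2 + μ n ^ 2 * w t ^ 2) := by
      nlinarith [sq_nonneg (v t), mul_nonneg q (sub_nonneg.2 c1.2)]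
    have u1' := mul_le_mul_of_nonneg_left u1 hμ.le
    have u2' := mul_le_mul_of_nonneg_left u2 hμ.le
    have e1 : μ n * ((v b ^ 2 + μ n ^ 2 * (coeff μ ε b * 0 ^ 2)) * Real.exp (128 * P))
        = Real.exp (128 * P - 130 * S) := by
      have : 128 * P - 130 * S = -130 * S + 128 * P := by ring
      rw [this, Real.exp_add, ← hwb.2]; ring
    rw [e1] at u1'
    constructor
    · have := mul_le_mul_of_nonneg_left E1 hμ.le
      linarith
    · have e2 : Real.exp (-130 * S - 128 * P) ≤ μ n * E := by
        calc Real.exp (-130 * S - 128 * P)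
            = μ n * (v b ^ 2 + μ n ^ 2 * (coeff μ ε b * 0 ^ 2)) * Real.exp (-(128 * P)) := by
              rw [sub_eq_add_neg, Real.exp_add, ← hwb.2]; ring
          _ ≤ μ n * (E * Real.exp (128 * P)) * Real.exp (-(128 * P)) := by gcongr
          _ = μ n * E * (Real.exp (128 * P) * Real.exp (-(128 * P))) := by ring
          _ = _ := by rw [← Real.exp_add]; simp
      have := mul_le_mul_of_nonneg_left E2 hμ.le
      linarith
  have hG0 : 0 ≤ G := by
    have := growth_monotone (by positivity : 0 ≤ burstCount μ n * Real.pi)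
    rw [growth_zero] at this
    have := h.eps_nonneg n
    positivity
  have three_le : (3 : ℝ) ≤ Real.exp 14 := by linarith [Real.add_one_le_exp (14 : ℝ)]
  refine ⟨w, v, hwv, fun t ht => ?_, ?_, fun t ht => ?_⟩
  · rcases le_total t a with hta | hta
    · refine (early t ⟨ht.1, hta⟩).trans (Real.exp_le_exp.2 ?_)
      linarith
    rcases le_total t b with htb | htb
    · refine (middle t ⟨hta, htb⟩).trans ?_
      calc 3 * Real.exp (-130 * S) ≤ Real.exp 14 * Real.exp (-130 * S) := by gcongr
        _ = Real.exp (14 + -130 * S) := by rw [Real.exp_add]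
        _ ≤ _ := Real.exp_le_exp.2 (by linarith)
    · refine (late t ⟨htb, ht.2⟩).1.trans ?_
      calc 2 * Real.exp (128 * P - 130 * S) ≤ Real.exp 14 * Real.exp (128 * P - 130 * S) := by
            gcongr; linarith
        _ = Real.exp (14 + (128 * P - 130 * S)) := by rw [Real.exp_add]
        _ ≤ _ := Real.exp_le_exp.2 (by linarith)
  · refine (early 0 ⟨by norm_num, ha0.le⟩).trans (Real.exp_le_exp.2 ?_)
    linarith
  · refine le_trans ?_ (late t ⟨hbe.trans ht.1, ht.2⟩).2
    have h1 : Real.exp (-1) ≤ 2 / 3 := by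
      have := Real.add_one_le_exp (1 : ℝ)
      rw [Real.exp_neg, inv_le_comm₀ (Real.exp_pos _) (by norm_num)]
      linarith
    -- Here 1 ≤ n ≤ S and P ≤ S, so 1 + 130 S + 128 P ≤ 259 S.
    calc Real.exp (-300 * S) ≤ Real.exp (-1 + (-130 * S - 128 * P)) :=
          Real.exp_le_exp.2 (by linarith)
      _ = Real.exp (-1) * Real.exp (-130 * S - 128 * P) := Real.exp_add _ _
      _ ≤ _ := by gcongr

end Kirchhoff

namespace Kirchhoff

/-! ### Choice of the frequencies -/

theorem exists_seq_of_forall_eventually {Q : ℕ → ℕ → ℕ → Prop}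
    (hQ : ∀ n i, ∀ᶠ j in atTop, Q n i j) : ∃ k : ℕ → ℕ, ∀ n, Q n (k n) (k (n + 1)) := by
  choose f hf using fun n i => (hQ n i).exists
  exact ⟨fun n => Nat.rec 0 f n, fun n => hf n _⟩

theorem IsContinuityModulus.tendsto_zero {ω : ℝ → ℝ} (hω : IsContinuityModulus ω) {ι : Type*}
    {l : Filter ι} {x : ι → ℝ} (hx0 : ∀ i, 0 ≤ x i) (hx : Tendsto x l (𝓝 0)) :
    Tendsto (fun i => ω (x i)) l (𝓝 0) := by
  have h := hω.continuousOn 0 (mem_Ici.2 le_rfl)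
  rw [ContinuousWithinAt, hω.zero] at h
  exact h.comp (tendsto_nhdsWithin_iff.2 ⟨hx, Eventually.of_forall hx0⟩)

/-- For x above the wavelength 1/ν this is monotonicity of ω; below it, monotonicity of s / ω s. -/
theorem IsContinuityModulus.mul_min_le {ω : ℝ → ℝ} (hω : IsContinuityModulus ω)
    (hω' : MonotoneOn (fun s => s / ω s) (Ioi 0)) (hpos : ∀ x, 0 < x → 0 < ω x) {ν x : ℝ}
    (hν : 0 < ν) (hx : 0 ≤ x) : ω (1 / ν) * min 1 (ν * x) ≤ ω x := by
  have h0 : 0 < 1 / ν := by positivity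
  rcases le_total 1 (ν * x) with h1 | h1
  · rw [min_eq_left h1, mul_one]
    exact hω.monotoneOn h0.le hx (by rwa [div_le_iff₀' hν])
  · rw [min_eq_right h1]
    rcases hx.eq_or_lt with rfl | hx
    · simp [hω.zero]
    · have := hω' hx h0 (by rwa [le_div_iff₀' hν])
      simp only at this
      rw [div_le_div_iff₀ (hpos x hx) (hpos _ h0)] at this
      calc ω (1 / ν) * (ν * x) = ν * (x * ω (1 / ν)) := by ring
        _ ≤ ν * (1 / ν * ω x) := by gcongr
        _ = ω x := by field_simp

theorem exists_isResonantSeq {lam : ℕ → ℝ} (hlam_pos : ∀ k, 0 < lam k) (hlam_mono : Monotone lam)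
    (hlam_unbdd : Tendsto lam atTop atTop) {ω : ℝ → ℝ} (hω : IsContinuityModulus ω)
    (hω' : MonotoneOn (fun s => s / ω s) (Ioi 0)) {φ : ℝ → ℝ} (hφ : ∀ s, 0 ≤ s → 1 ≤ φ s)
    (hlim : Tendsto (fun k => lam k / φ (lam k) * ω (1 / lam k)) atTop atTop) :
    ∃ k : ℕ → ℕ, StrictMono k ∧ ∃ ε : ℕ → ℝ, IsResonantSeq φ (fun n => lam (k n)) ε ∧
      ∀ n x, 0 ≤ x → ε n * min 1 (lam (k n) * x) ≤ ω x := by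
  have hinv : Tendsto (fun j => 1 / lam j) atTop (𝓝 0) := by
    simp only [one_div]
    exact hlam_unbdd.inv_tendsto_atTop
  have hωlim : Tendsto (fun j => ω (1 / lam j)) atTop (𝓝 0) :=
    hω.tendsto_zero (fun j => (one_div_pos.2 (hlam_pos j)).le) hinv
  have hφ0 (j : ℕ) : 0 < φ (lam j) := by linarith [hφ _ (hlam_pos j).le]
  have hω0 (j : ℕ) : 0 ≤ ω (1 / lam j) := hω.nonneg _ (one_div_pos.2 (hlam_pos j)).le
  -- Positivity is forced by the limit hypothesis at arbitrarily small 1 / λ_j, then propagated by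
  -- monotonicity.
  have hpos (x : ℝ) (hx : 0 < x) : 0 < ω x := by
    obtain ⟨j, h1, h2⟩ := ((hinv.eventually (Iio_mem_nhds hx)).and
      (hlim.eventually_gt_atTop 0)).exists
    have h1 : 1 / lam j < x := h1
    have h3 : 0 < ω (1 / lam j) := pos_of_mul_pos_right h2 (div_pos (hlam_pos j) (hφ0 j)).le
    exact h3.trans_le (hω.monotoneOn (one_div_pos.2 (hlam_pos j)).le hx.le h1.le)
  -- Summing over all indices up to i, not only the selected ones, makes the condition on the next
  -- index depend on i alone; it dominates the sum in `gap`.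
  let S : ℕ → ℝ := fun i => ∑ l ∈ Finset.range (i + 1), lam l * ω (1 / lam l)
  obtain ⟨k, hk⟩ := exists_seq_of_forall_eventually (Q := fun n i j => i < j ∧
      ω (1 / lam j) ≤ 1 / 14 ∧ lam i * ω (1 / lam j) ≤ 1 ∧ 8 * 2 ^ (n + 1) ≤ lam j ∧
      8 * 2 ^ (n + 1) * ((n + 1 : ℕ) : ℝ) ≤ lam j / φ (lam j) * ω (1 / lam j) ∧
      Real.exp ((n + 1 : ℕ) * ((n + 1 : ℕ) + S i)) ≤ lam j) (fun n i => by
    have h3 : Tendsto (fun j => lam i * ω (1 / lam j)) atTop (𝓝 0) := by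
      simpa using hωlim.const_mul (lam i)
    filter_upwards [eventually_gt_atTop i, hωlim.eventually (Iic_mem_nhds
      (by norm_num : (0 : ℝ) < 1 / 14)),
      h3.eventually (Iic_mem_nhds one_pos), hlam_unbdd.eventually_ge_atTop (8 * 2 ^ (n + 1)),
      hlim.eventually_ge_atTop (8 * 2 ^ (n + 1) * ((n + 1 : ℕ) : ℝ)),
      hlam_unbdd.eventually_ge_atTop (Real.exp ((n + 1 : ℕ) * ((n + 1 : ℕ) + S i)))]
      with j a b c d e f
    exact ⟨a, b, c, d, e, f⟩)
  have kmono : StrictMono k := strictMono_nat_of_lt_succ fun n => (hk n).1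
  -- The recursion imposes nothing on the size of the first frequency, so mode 0 carries no burst.
  let ε : ℕ → ℝ := fun n => if n = 0 then 0 else ω (1 / lam (k n))
  have hε0 : ε 0 = 0 := rfl
  have hε (n : ℕ) : ε (n + 1) = ω (1 / lam (k (n + 1))) := rfl
  have hεle (n : ℕ) : ε n ≤ ω (1 / lam (k n)) := by
    cases n with
    | zero => exact hω0 _
    | succ n => exact (hε n).le
  have hsum (n : ℕ) : ∑ m ∈ Finset.range (n + 1), lam (k m) * ε m ≤ S (k n) := by
    calc _ ≤ ∑ m ∈ Finset.range (n + 1), lam (k m) * ω (1 / lam (k m)) :=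
          Finset.sum_le_sum fun m _ => mul_le_mul_of_nonneg_left (hεle m) (hlam_pos _).le
      _ = ∑ l ∈ (Finset.range (n + 1)).map ⟨k, kmono.injective⟩, lam l * ω (1 / lam l) := by
          rw [Finset.sum_map]; rfl
      _ ≤ _ := by
          refine Finset.sum_le_sum_of_subset_of_nonneg (fun l hl => ?_)
            fun l _ _ => mul_nonneg (hlam_pos _).le (hω0 l)
          obtain ⟨m, hm, rfl⟩ := Finset.mem_map.1 hl
          have := kmono.monotone (Nat.lt_succ_iff.1 (Finset.mem_range.1 hm))
          exact Finset.mem_range.2 (Nat.lt_succ_iff.2 this)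
  refine ⟨k, kmono, ε, ⟨fun n => hlam_pos _, fun n => ?_, hε0, fun n => ?_, fun m n hmn => ?_,
    fun n hn => ?_, fun n hn => ?_, fun n hn => ?_⟩, fun n x hx => ?_⟩
  · cases n with
    | zero => exact hε0.ge
    | succ n => exact hω0 _
  · cases n with
    | zero => rw [hε0]; norm_num
    | succ n => exact (hk n).2.1
  · obtain ⟨n, rfl⟩ := Nat.exists_eq_succ_of_ne_zero (Nat.ne_zero_of_lt hmn)
    refine le_trans ?_ (hk n).2.2.1
    exact mul_le_mul_of_nonneg_right
      (hlam_mono (kmono.monotone (Nat.lt_succ_iff.1 hmn))) (hω0 _)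
  · obtain ⟨n, rfl⟩ := Nat.exists_eq_succ_of_ne_zero hn.ne'
    exact (hk n).2.2.2.1
  · obtain ⟨n, rfl⟩ := Nat.exists_eq_succ_of_ne_zero hn.ne'
    have := (hk n).2.2.2.2.1
    rw [div_mul_eq_mul_div, le_div_iff₀ (hφ0 _), mul_assoc] at this
    exact this
  · obtain ⟨n, rfl⟩ := Nat.exists_eq_succ_of_ne_zero hn.ne'
    refine le_trans (Real.exp_le_exp.2 ?_) (hk n).2.2.2.2.2
    gcongr
    exact hsum n
  · cases n with
    | zero => rw [hε0, zero_mul]; exact hω.nonneg x hx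
    | succ n => exact hω.mul_min_le hω' hpos (hlam_pos _) hx

/-! ### The family of modes -/

variable {φ : ℝ → ℝ} {μ ε : ℕ → ℝ}

theorem IsResonantSeq.continuous_coeff (h : IsResonantSeq φ μ ε) {ω : ℝ → ℝ}
    (hω0 : IsContinuityModulus ω) (hω : ∀ n x, 0 ≤ x → ε n * min 1 (μ n * x) ≤ ω x) :
    Continuous (coeff μ ε) := by
  refine continuous_iff_continuousAt.2 fun t => ?_
  rw [ContinuousAt, tendsto_iff_dist_tendsto_zero]
  have h1 : Tendsto (fun s => |s - t|) (𝓝 t) (𝓝 0) := by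
    have : Continuous fun s => |s - t| := by fun_prop
    simpa using this.tendsto t
  have h2 := (hω0.tendsto_zero (fun s => abs_nonneg (s - t)) h1).const_mul 64
  rw [mul_zero] at h2
  exact squeeze_zero (fun _ => dist_nonneg) (fun s => h.abs_coeff_sub_le hω s t) h2

theorem summable_exp_neg_two_mul : Summable fun n : ℕ => Real.exp (-2 * n) := by
  simpa [mul_comm] using Real.summable_exp_nat_mul_iff.2 (by norm_num : (-2 : ℝ) < 0)

theorem abs_mul_le_energy {ν x y : ℝ} (hν : 0 < ν) :
    |ν ^ 2 * (x * y)| ≤ ν * (y ^ 2 + ν ^ 2 * x ^ 2) := by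
  have : |ν * x * y| ≤ y ^ 2 + ν ^ 2 * x ^ 2 := by
    rw [abs_le]
    constructor <;> nlinarith [sq_nonneg (ν * x + y), sq_nonneg (ν * x - y), sq_nonneg (ν * x),
      sq_nonneg y]
  calc |ν ^ 2 * (x * y)| = ν * |ν * x * y| := by
        rw [← abs_of_pos hν, ← abs_mul, abs_of_pos hν]; ring_nf
    _ ≤ _ := by gcongr

/-- The components of the solution. -/
theorem IsResonantSeq.exists_modes (h : IsResonantSeq φ μ ε) (hc : Continuous (coeff μ ε)) :
    ∃ w v : ℕ → ℝ → ℝ, (∀ n, IsOscillator (coeff μ ε) (μ n) (Ioo (-1) 2) (w n) (v n)) ∧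
      (∃ M, ∀ n, ∀ t ∈ Ioo (-1 : ℝ) 2,
        μ n * (v n t ^ 2 + μ n ^ 2 * w n t ^ 2) ≤ M * Real.exp (-2 * n)) ∧
      (∀ n, 0 < n → μ n * (v n 0 ^ 2 + μ n ^ 2 * w n 0 ^ 2)
        ≤ Real.exp (14 - 2 * n - 2 * (n * φ (μ n)))) ∧
      (∀ n, 0 < n → ∀ t ∈ Ico (2 * (1 / 2) ^ n) (2 : ℝ),
        Real.exp (-300 * lossRate μ ε n) ≤ μ n * (v n t ^ 2 + μ n ^ 2 * w n t ^ 2)) ∧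
      0 < ∑' n, μ n ^ 2 * (w n 0 * v n 0) := by
  choose W V hWV hsup hinit hlate using fun n : ℕ => h.exists_mode hc (Nat.succ_pos n)
  have z : (0 : ℝ) ∈ Ioo (-1) 2 := by norm_num
  have hsup' (n : ℕ) (t : ℝ) (ht : t ∈ Ioo (-1 : ℝ) 2) :
      μ (n + 1) * (V n t ^ 2 + μ (n + 1) ^ 2 * W n t ^ 2)
        ≤ Real.exp 14 * Real.exp (-2 * ((n + 1 : ℕ) : ℝ)) := by
    rw [← Real.exp_add]
    exact (hsup n t ht).trans_eq (by rw [sub_eq_add_neg, neg_mul])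
  have hsum : Summable fun n : ℕ => Real.exp 14 * Real.exp (-2 * ((n + 1 : ℕ) : ℝ)) :=
    ((summable_nat_add_iff 1).2 summable_exp_neg_two_mul).mul_left _
  set C := ∑' n : ℕ, Real.exp 14 * Real.exp (-2 * ((n + 1 : ℕ) : ℝ)) with hC
  have hC0 : 0 ≤ C := tsum_nonneg fun n => by positivity
  have hb (n : ℕ) : ‖μ (n + 1) ^ 2 * (W n 0 * V n 0)‖
      ≤ Real.exp 14 * Real.exp (-2 * ((n + 1 : ℕ) : ℝ)) :=
    (abs_mul_le_energy (h.mu_pos _)).trans (hsup' n 0 z)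
  have hμ := h.mu_pos 0
  -- Mode 0 contributes C + 1 to the final series, while all other modes together contribute at most
  -- C in absolute value.
  set κ := Real.sqrt (C + 1) / μ 0 with hκ
  obtain ⟨w₀, v₀, hw0, hv0, hwv0⟩ := exists_isOscillator hc
    (fun t => abs_le.2 ⟨by linarith [(h.coeff_mem t).1], by linarith [(h.coeff_mem t).2]⟩) (μ 0)
    (t₀ := 0) (by norm_num) κ κ
  obtain ⟨w, rfl, hw⟩ : ∃ w : ℕ → ℝ → ℝ, w 0 = w₀ ∧ ∀ n, w (n + 1) = W n :=
    ⟨fun n => Nat.casesOn n w₀ W, rfl, fun _ => rfl⟩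
  obtain ⟨v, rfl, hv⟩ : ∃ v : ℕ → ℝ → ℝ, v 0 = v₀ ∧ ∀ n, v (n + 1) = V n :=
    ⟨fun n => Nat.casesOn n v₀ V, rfl, fun _ => rfl⟩
  simp only [← hw, ← hv] at hWV hsup' hinit hlate hb
  refine ⟨w, v, ?_, ?_, ?_, ?_, ?_⟩
  · rintro (_ | n)
    exacts [hwv0, hWV n]
  · set M₀ := μ 0 * ((κ ^ 2 + μ 0 ^ 2 * κ ^ 2) * Real.exp (μ 0 * (1 / 2) * 2))
    refine ⟨max M₀ (Real.exp 14), ?_⟩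
    rintro (_ | n) t ht
    · have := hwv0.energy_le hμ (convex_Ioo _ _) (K := μ 0 * (1 / 2))
        (fun s _ => mul_le_mul_of_nonneg_left (h.abs_one_sub_coeff_le s) hμ.le) z ht
      rw [hw0, hv0] at this
      simp only [Nat.cast_zero, mul_zero, Real.exp_zero, mul_one]
      refine le_trans ?_ (le_max_left _ _)
      have ht2 : |t - 0| ≤ 2 := abs_le.2 ⟨by linarith [ht.1], by linarith [ht.2]⟩
      refine mul_le_mul_of_nonneg_left (this.trans ?_) hμ.le
      gcongr
    · refine (hsup' n t ht).trans ?_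
      gcongr
      exact le_max_right _ _
  · rintro (_ | n) hn
    exacts [absurd hn (lt_irrefl _), hinit n]
  · rintro (_ | n) hn
    exacts [absurd hn (lt_irrefl _), hlate n]
  · have hs : Summable fun n => μ (n + 1) ^ 2 * (w (n + 1) 0 * v (n + 1) 0) :=
      Summable.of_norm_bounded hsum hb
    rw [Summable.tsum_eq_zero_add
      ((summable_nat_add_iff (f := fun n => μ n ^ 2 * (w n 0 * v n 0)) 1).1 hs)]
    have h1 : |∑' n, μ (n + 1) ^ 2 * (w (n + 1) 0 * v (n + 1) 0)| ≤ C :=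
      tsum_of_norm_bounded hsum.hasSum hb
    have h2 : μ 0 ^ 2 * (κ * κ) = C + 1 := by
      rw [hκ]
      have := Real.mul_self_sqrt (by linarith : 0 ≤ C + 1)
      field_simp
      linarith
    rw [hw0, hv0, h2]
    linarith [(abs_le.1 h1).1]

end Kirchhoff

namespace Kirchhoff

/-! ### Uniqueness of the spectral measure -/

section Stieltjes

theorem ae_nonneg_of_Iio {P : Measure ℝ} (hP : P (Iio 0) = 0) : ∀ᵐ l ∂P, 0 ≤ l := by
  rw [ae_iff]
  simp only [not_le]
  exact hP

variable {P Q : Measure ℝ} [IsFiniteMeasure P] [IsFiniteMeasure Q]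

theorem integrable_resolvent_pow (hP : P (Iio 0) = 0) (k : ℕ) {s : ℝ} (hs : 0 < s) :
    Integrable (fun l => ((l + s) ^ k)⁻¹) P := by
  refine (integrable_const ((s ^ k)⁻¹)).mono' (by fun_prop) ?_
  filter_upwards [ae_nonneg_of_Iio hP] with l hl
  rw [Real.norm_of_nonneg (by positivity)]
  gcongr
  linarith

theorem hasDerivAt_integral_resolvent_pow (hP : P (Iio 0) = 0) (k : ℕ) {s : ℝ} (hs : 0 < s) :
    HasDerivAt (fun s => ∫ l, ((l + s) ^ (k + 1))⁻¹ ∂P)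
      (-(k + 1) * ∫ l, ((l + s) ^ (k + 2))⁻¹ ∂P) s := by
  have := hasDerivAt_integral_of_dominated_loc_of_deriv_le (μ := P)
    (F := fun s l => ((l + s) ^ (k + 1))⁻¹) (x₀ := s) (s := Ioi (s / 2))
    (F' := fun s l => -(k + 1) * ((l + s) ^ (k + 2))⁻¹)
    (bound := fun _ => (k + 1) * ((s / 2) ^ (k + 2))⁻¹)
    (Ioi_mem_nhds (by linarith)) (Eventually.of_forall fun _ => by fun_prop)
    (integrable_resolvent_pow hP _ hs) (by fun_prop)
    (by
      filter_upwards [ae_nonneg_of_Iio hP] with l hl x hx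
      have hx' : s / 2 < x := hx
      rw [norm_mul, norm_neg, Real.norm_of_nonneg (by positivity : (0 : ℝ) ≤ k + 1),
        Real.norm_of_nonneg (by have : 0 < x := by linarith
                                positivity)]
      gcongr
      linarith)
    (integrable_const _)
    (by
      filter_upwards [ae_nonneg_of_Iio hP] with l hl x hx
      have hx' : s / 2 < x := hx
      have h0 : l + x ≠ 0 := by linarith
      have := (((hasDerivAt_id x).const_add l).pow (k + 1)).inv (pow_ne_zero _ h0)
      convert! this using 1
      simp only [id_eq, Nat.cast_add, Nat.cast_one, add_tsub_cancel_right, mul_one,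
        Pi.pow_apply]
      field_simp
      ring)
  rw [← integral_const_mul]
  exact this.2

/-- Each differentiation in s raises the power of the resolvent kernel by one. -/
theorem integral_resolvent_pow_eq (hP : P (Iio 0) = 0) (hQ : Q (Iio 0) = 0)
    (h : ∀ s : ℝ, 0 < s → ∫ l, (l + s)⁻¹ ∂P = ∫ l, (l + s)⁻¹ ∂Q) (k : ℕ) :
    ∀ s : ℝ, 0 < s → ∫ l, ((l + s) ^ (k + 1))⁻¹ ∂P = ∫ l, ((l + s) ^ (k + 1))⁻¹ ∂Q := by
  induction k with
  | zero => simpa using h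
  | succ k ih =>
    intro s hs
    have e : (fun s => ∫ l, ((l + s) ^ (k + 1))⁻¹ ∂P)
        =ᶠ[𝓝 s] fun s => ∫ l, ((l + s) ^ (k + 1))⁻¹ ∂Q := by
      filter_upwards [Ioi_mem_nhds hs] with x hx
      exact ih x hx
    have := (hasDerivAt_integral_resolvent_pow hP k hs).unique
      ((hasDerivAt_integral_resolvent_pow hQ k hs).congr_of_eventuallyEq e)
    have hk : -((k : ℝ) + 1) ≠ 0 := by
      have : (0 : ℝ) ≤ k := Nat.cast_nonneg k
      linarith
    exact mul_left_cancel₀ hk this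

/-- Recovers the total mass, the power zero that differentiation of the transform does not reach. -/
theorem tendsto_mul_integral_resolvent (hP : P (Iio 0) = 0) :
    Tendsto (fun s : ℝ => s * ∫ l, (l + s)⁻¹ ∂P) atTop (𝓝 (P.real univ)) := by
  have h1 : P.real univ = ∫ _, (1 : ℝ) ∂P := by simp
  simp_rw [h1, ← integral_const_mul]
  refine tendsto_integral_filter_of_dominated_convergence (fun _ => 1)
    (Eventually.of_forall fun s => by fun_prop) ?_ (integrable_const _) ?_
  · filter_upwards [eventually_gt_atTop 0] with s hs
    filter_upwards [ae_nonneg_of_Iio hP] with l hl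
    rw [Real.norm_of_nonneg (by positivity), ← div_eq_mul_inv, div_le_one (by positivity)]
    linarith
  · refine Eventually.of_forall fun l => ?_
    have h2 : Tendsto (fun s : ℝ => 1 - l * (l + s)⁻¹) atTop (𝓝 (1 - l * 0)) :=
      ((tendsto_inv_atTop_zero.comp (tendsto_atTop_add_const_left _ l tendsto_id)).const_mul
        l).const_sub 1
    rw [mul_zero, sub_zero] at h2
    refine h2.congr' ?_
    filter_upwards [eventually_gt_atTop (-l)] with s hs
    have : l + s ≠ 0 := by linarith
    field_simp
    ring

/-- A bounded continuous injective function that is equal to `(l + 1)⁻¹` for `l ≥ 0`. -/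
noncomputable def resolventFun : BoundedContinuousFunction ℝ ℝ :=
  BoundedContinuousFunction.ofNormedAddCommGroup (fun l => 1 - l * (1 + |l|)⁻¹)
    (by
      refine continuous_const.sub (continuous_id.mul (Continuous.inv₀ (by fun_prop) fun l => ?_))
      positivity) 2
    (fun l => by
      have h : |l * (1 + |l|)⁻¹| ≤ 1 := by
        rw [← div_eq_mul_inv, abs_div, abs_of_pos (by positivity : 0 < 1 + |l|),
          div_le_one (by positivity)]
        linarith
      rw [Real.norm_eq_abs]
      have := abs_le.1 h
      rw [abs_le]; constructor <;> linarith)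

theorem resolventFun_apply (l : ℝ) : resolventFun l = 1 - l * (1 + |l|)⁻¹ := rfl

theorem resolventFun_of_nonneg {l : ℝ} (hl : 0 ≤ l) : resolventFun l = (l + 1)⁻¹ := by
  rw [resolventFun_apply, abs_of_nonneg hl]
  field_simp
  ring

theorem resolventFun_injective : Function.Injective resolventFun := by
  intro a b h
  rw [resolventFun_apply, resolventFun_apply, sub_right_inj, ← div_eq_mul_inv, ← div_eq_mul_inv,
    div_eq_div_iff (by positivity) (by positivity)] at h
  rcases le_total 0 a with ha | ha <;> rcases le_total 0 b with hb | hb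
  · rw [abs_of_nonneg ha, abs_of_nonneg hb] at h; linarith
  · rw [abs_of_nonneg ha, abs_of_nonpos hb] at h; nlinarith
  · rw [abs_of_nonpos ha, abs_of_nonneg hb] at h; nlinarith
  · rw [abs_of_nonpos ha, abs_of_nonpos hb] at h; linarith

/-- A finite measure on `[0, ∞)` is determined by its Stieltjes transform. -/
theorem measure_eq_of_stieltjes_eq (hP : P (Iio 0) = 0) (hQ : Q (Iio 0) = 0)
    (h : ∀ s : ℝ, 0 < s → ∫ l, (l + s)⁻¹ ∂P = ∫ l, (l + s)⁻¹ ∂Q) : P = Q := by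
  -- Polynomials in `resolventFun` separate points by injectivity, and their integrals are
  -- combinations of those of (l + 1)⁻ᵏ.
  let S : StarSubalgebra ℝ (BoundedContinuousFunction ℝ ℝ) :=
    { (Polynomial.aeval (R := ℝ) resolventFun).range with
      star_mem' := fun {g} hg => by
        have : star g = g := by ext; simp
        rwa [this] }
  refine ext_of_forall_mem_subalgebra_integral_eq_of_polish (𝕜 := ℝ) (A := S) ?_ ?_
  · intro a b hab
    refine ⟨resolventFun, ⟨resolventFun.toContinuousMapStarₐ ℝ, ⟨resolventFun, ?_, rfl⟩, rfl⟩,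
      fun e => hab (resolventFun_injective e)⟩
    exact ⟨Polynomial.X, by simp⟩
  · rintro _ ⟨p, rfl⟩
    change ∫ l, (Polynomial.aeval resolventFun p) l ∂P = ∫ l, (Polynomial.aeval resolventFun p) l ∂Q
    induction p using Polynomial.induction_on' with
    | add p q hp hq =>
      simp only [map_add, BoundedContinuousFunction.coe_add, Pi.add_apply]
      rw [integral_add (BoundedContinuousFunction.integrable _ _)
        (BoundedContinuousFunction.integrable _ _), integral_add
        (BoundedContinuousFunction.integrable _ _) (BoundedContinuousFunction.integrable _ _),
        hp, hq]
    | monomial k a =>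
      have e (ν : Measure ℝ) (hν : ν (Iio 0) = 0) :
          ∫ l, (Polynomial.aeval resolventFun (Polynomial.monomial k a)) l ∂ν
            = a * ∫ l, ((l + 1) ^ k)⁻¹ ∂ν := by
        rw [← integral_const_mul]
        refine integral_congr_ae ?_
        filter_upwards [ae_nonneg_of_Iio hν] with l hl
        rw [Polynomial.aeval_monomial, Algebra.algebraMap_eq_smul_one, smul_mul_assoc, one_mul,
          BoundedContinuousFunction.coe_smul, BoundedContinuousFunction.coe_pow]
        simp only [Pi.pow_apply, resolventFun_of_nonneg hl, smul_eq_mul, inv_pow]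
      rw [e P hP, e Q hQ]
      congr 1
      cases k with
      | zero =>
        have h1 := tendsto_mul_integral_resolvent hP
        have h2 := tendsto_mul_integral_resolvent hQ
        have := tendsto_nhds_unique h1 (h2.congr' (by
          filter_upwards [eventually_gt_atTop 0] with s hs
          rw [h s hs]))
        simpa using this
      | succ k => exact integral_resolvent_pow_eq hP hQ h k 1 one_pos

end Stieltjes

variable {H : Type*} [NormedAddCommGroup H] [InnerProductSpace ℝ H]

theorem resolvent_unique {A : H →ₗ.[ℝ] H} (hA0 : IsNonneg A) {s : ℝ} (hs : 0 < s)
    {x : H} {y z : A.domain} (hy : A y + s • (y : H) = x) (hz : A z + s • (z : H) = x) :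
    y = z := by
  have h0 := hA0 (y - z)
  have e : A (y - z) = -(s • ((y - z : A.domain) : H)) := by
    rw [A.map_sub, Submodule.coe_sub, smul_sub]
    have : A y + s • (y : H) = A z + s • (z : H) := hy.trans hz.symm
    rw [sub_eq_iff_eq_add, ← add_right_cancel_iff (a := s • (y : H)), this]
    abel
  rw [e, inner_neg_left, real_inner_smul_left, real_inner_self_eq_norm_sq] at h0
  have h1 : ‖((y - z : A.domain) : H)‖ ^ 2 ≤ 0 := by
    by_contra hlt
    nlinarith [not_le.1 hlt]
  have h2 : ((y - z : A.domain) : H) = 0 := by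
    rw [← norm_eq_zero]
    exact pow_eq_zero_iff two_ne_zero |>.1 (le_antisymm h1 (sq_nonneg _))
  exact sub_eq_zero.1 (Subtype.ext h2)

theorem IsSpectralMeasure.unique {A : H →ₗ.[ℝ] H} (hA0 : IsNonneg A) {x : H} {P Q : Measure ℝ}
    (hP : IsSpectralMeasure A x P) (hQ : IsSpectralMeasure A x Q) : P = Q := by
  have := hP.finite
  have := hQ.finite
  refine measure_eq_of_stieltjes_eq hP.nonneg hQ.nonneg fun s hs => ?_
  obtain ⟨y, hy, ey⟩ := hP.resolvent s hs
  obtain ⟨z, hz, ez⟩ := hQ.resolvent s hs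
  rw [ey, ez, resolvent_unique hA0 hs hy hz]

/-- `spectralMeasure` is a choice; uniqueness makes it computable from any candidate. -/
theorem IsSpectralMeasure.spectralMeasure_eq {A : H →ₗ.[ℝ] H} (hA0 : IsNonneg A) {x : H}
    {P : Measure ℝ} (hP : IsSpectralMeasure A x P) : spectralMeasure A x = P := by
  have h : ∃ ν, IsSpectralMeasure A x ν := ⟨P, hP⟩
  rw [spectralMeasure, dif_pos h]
  exact h.choose_spec.unique hA0 hP

end Kirchhoff

namespace Kirchhoff

/-! ### Combinations of eigenvectors -/

theorem summable_sq_of_summable_abs {x : ℕ → ℝ} (hx : Summable fun n => |x n|) :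
    Summable (fun n => x n ^ 2) ∧ ∑' n, x n ^ 2 ≤ (∑' n, |x n|) ^ 2 := by
  have hle (n : ℕ) : x n ^ 2 ≤ (∑' n, |x n|) * |x n| := by
    rw [← sq_abs, sq]
    exact mul_le_mul_of_nonneg_right (hx.le_tsum n fun _ _ => abs_nonneg _) (abs_nonneg _)
  have hs : Summable (fun n => x n ^ 2) :=
    Summable.of_nonneg_of_le (fun n => sq_nonneg _) hle (hx.mul_left _)
  refine ⟨hs, ?_⟩
  rw [sq (∑' n, |x n|), ← tsum_mul_left]
  exact hs.tsum_le_tsum hle (hx.mul_left _)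

/-- The discrete measure with masses `x n ^ 2` at the points `μ n ^ 2`. -/
noncomputable def diagMeasure (μ x : ℕ → ℝ) : Measure ℝ :=
  Measure.sum fun n => ENNReal.ofReal (x n ^ 2) • Measure.dirac (μ n ^ 2)

theorem toReal_ofReal_sq (x : ℝ) : (ENNReal.ofReal (x ^ 2)).toReal = x ^ 2 :=
  ENNReal.toReal_ofReal (sq_nonneg x)

theorem integrable_diagMeasure_iff {μ x : ℕ → ℝ} {f : ℝ → ℝ} :
    Integrable f (diagMeasure μ x) ↔ Summable fun n => x n ^ 2 * |f (μ n ^ 2)| := by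
  rw [diagMeasure, integrable_sum_dirac_iff fun _ => ENNReal.ofReal_ne_top]
  simp only [toReal_ofReal_sq, Real.norm_eq_abs]

theorem integral_diagMeasure (μ x : ℕ → ℝ) (f : ℝ → ℝ) :
    ∫ l, f l ∂diagMeasure μ x = ∑' n, x n ^ 2 * f (μ n ^ 2) := by
  rw [diagMeasure, integral_sum_dirac fun _ => ENNReal.ofReal_ne_top]
  simp only [toReal_ofReal_sq, smul_eq_mul]

theorem memLp_diagMeasure_iff {μ x : ℕ → ℝ} {f : ℝ → ℝ} :
    MemLp f 2 (diagMeasure μ x) ↔ Summable fun n => (x n * f (μ n ^ 2)) ^ 2 := by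
  -- On a countable sum of Dirac masses every function is measurable, so no measurability of φ is
  -- needed.
  have hm : AEStronglyMeasurable f (diagMeasure μ x) :=
    aestronglyMeasurable_sum_measure_iff.2 fun n =>
      aestronglyMeasurable_dirac.smul_measure _
  rw [memLp_two_iff_integrable_sq hm, integrable_diagMeasure_iff]
  simp only [abs_sq, mul_pow]

theorem eLpNorm_diagMeasure {μ x : ℕ → ℝ} {f : ℝ → ℝ}
    (h : Summable fun n => (x n * f (μ n ^ 2)) ^ 2) :
    eLpNorm f 2 (diagMeasure μ x) = ENNReal.ofReal √(∑' n, (x n * f (μ n ^ 2)) ^ 2) := by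
  rw [(memLp_diagMeasure_iff.2 h).eLpNorm_eq_integral_rpow_norm two_ne_zero ENNReal.ofNat_ne_top]
  simp only [ENNReal.toReal_ofNat, Real.rpow_two, Real.norm_eq_abs, sq_abs]
  rw [integral_diagMeasure, Real.sqrt_eq_rpow, one_div]
  simp only [mul_pow]

variable {H : Type*} [NormedAddCommGroup H] [InnerProductSpace ℝ H]

/-- The vector `∑ x_n e_n`. -/
noncomputable def diagVec (e : ℕ → H) (x : ℕ → ℝ) : H := ∑' n, x n • e n

theorem smul_diagVec (e : ℕ → H) (c : ℝ) (x : ℕ → ℝ) :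
    c • diagVec e x = diagVec e (fun n => c * x n) := by
  simp only [diagVec, mul_smul]
  exact (tsum_const_smul'' c).symm

theorem norm_smul_orthonormal {e : ℕ → H} (he : Orthonormal ℝ e) (x : ℝ) (n : ℕ) : ‖x • e n‖ = |x| := by
  rw [norm_smul, he.1 n, mul_one, Real.norm_eq_abs]

theorem norm_diagVec_le {e : ℕ → H} (he : Orthonormal ℝ e) {x : ℕ → ℝ} (hx : Summable fun n => |x n|) :
    ‖diagVec e x‖ ≤ ∑' n, |x n| :=
  tsum_of_norm_bounded hx.hasSum fun _ => (norm_smul_orthonormal he _ _).le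

section diagVec

variable [CompleteSpace H] {e : ℕ → H} (he : Orthonormal ℝ e)

include he

theorem summable_smul_orthonormal {x : ℕ → ℝ} (hx : Summable fun n => |x n|) :
    Summable fun n => x n • e n :=
  Summable.of_norm (by simpa only [norm_smul_orthonormal he] using hx)

theorem hasSum_inner_diagVec {x : ℕ → ℝ} (hx : Summable fun n => |x n|) (y : H) :
    HasSum (fun n => x n * inner ℝ (e n) y) (inner ℝ (diagVec e x) y) := by
  have := (summable_smul_orthonormal he hx).hasSum.mapL (innerSL ℝ y)
  simpa [inner_smul_right, real_inner_comm, diagVec] using this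

theorem inner_orthonormal_diagVec {x : ℕ → ℝ} (hx : Summable fun n => |x n|) (n : ℕ) :
    inner ℝ (e n) (diagVec e x) = x n := by
  rw [real_inner_comm, ← (hasSum_inner_diagVec he hx (e n)).tsum_eq, tsum_eq_single n]
  · rw [real_inner_self_eq_norm_sq, he.1 n]; norm_num
  · intro m hm
    rw [he.2 hm, mul_zero]

theorem diagVec_sub {x y : ℕ → ℝ} (hx : Summable fun n => |x n|) (hy : Summable fun n => |y n|) :
    diagVec e x - diagVec e y = diagVec e (fun n => x n - y n) := by
  simp only [diagVec, sub_smul]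
  exact ((summable_smul_orthonormal he hx).tsum_sub (summable_smul_orthonormal he hy)).symm

variable {A : H →ₗ.[ℝ] H} {μ : ℕ → ℝ}

omit he in
theorem inner_eigenvector (hA : IsSelfAdjoint A)
    (heig : ∀ n, ∃ h : e n ∈ A.domain, A ⟨e n, h⟩ = (μ n ^ 2) • e n) (n : ℕ) (y : A.domain) :
    inner ℝ (e n) (A y) = μ n ^ 2 * inner ℝ (e n) (y : H) := by
  obtain ⟨h, hn⟩ := heig n
  have hf := LinearPMap.adjoint_isFormalAdjoint hA.dense_domain
  rw [LinearPMap.isSelfAdjoint_def.1 hA] at hf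
  have := hf ⟨e n, h⟩ y
  rw [hn, real_inner_smul_left] at this
  exact this.symm

/-- The resolvent is obtained by dividing coefficients. Testing against D(A) puts the resulting
vector in the domain of the adjoint, which is A; no partial sums are passed to the limit inside A.
-/
theorem exists_resolvent_diagVec (hA : IsSelfAdjoint A)
    (heig : ∀ n, ∃ h : e n ∈ A.domain, A ⟨e n, h⟩ = (μ n ^ 2) • e n) {x : ℕ → ℝ}
    (hx : Summable fun n => |x n|) {s : ℝ} (hs : 0 < s) :
    ∃ y : A.domain, A y + s • (y : H) = diagVec e x ∧
      (y : H) = diagVec e (fun n => x n * (μ n ^ 2 + s)⁻¹) := by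
  set z : ℕ → ℝ := fun n => x n * (μ n ^ 2 + s)⁻¹ with hz
  have hzs : Summable fun n => |z n| := by
    refine Summable.of_nonneg_of_le (fun _ => abs_nonneg _) (fun n => ?_) (hx.mul_right s⁻¹)
    rw [hz, abs_mul, abs_of_nonneg (by positivity : 0 ≤ (μ n ^ 2 + s)⁻¹)]
    gcongr
    linarith [sq_nonneg (μ n)]
  have key (y : A.domain) :
      inner ℝ (diagVec e x - s • diagVec e z) (y : H) = inner ℝ (diagVec e z) (A y) := by
    rw [inner_sub_left, real_inner_smul_left]
    have h1 := (hasSum_inner_diagVec he hx (y : H)).sub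
      ((hasSum_inner_diagVec he hzs (y : H)).mul_left s)
    refine h1.unique ?_
    convert! hasSum_inner_diagVec he hzs (A y) using 2 with n
    rw [inner_eigenvector hA heig n y]
    have : μ n ^ 2 + s ≠ 0 := by positivity
    simp only [hz]
    field_simp
    ring
  have hdom : diagVec e z ∈ A.domain := by
    rw [← LinearPMap.isSelfAdjoint_def.1 hA]
    exact LinearPMap.mem_adjoint_domain_of_exists _ ⟨_, key⟩
  have happ : A ⟨diagVec e z, hdom⟩ = diagVec e x - s • diagVec e z := by
    -- Transports a value along the equality of the adjoint with A, whose domains are equal only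
    -- propositionally.
    have gen (B : H →ₗ.[ℝ] H) (hB : B = A) (hd : diagVec e z ∈ B.domain) :
        B ⟨diagVec e z, hd⟩ = A ⟨diagVec e z, hdom⟩ := by subst hB; rfl
    rw [← gen _ (LinearPMap.isSelfAdjoint_def.1 hA)
      (LinearPMap.mem_adjoint_domain_of_exists _ ⟨_, key⟩)]
    exact LinearPMap.adjoint_apply_eq hA.dense_domain _ key
  exact ⟨⟨diagVec e z, hdom⟩, by rw [happ, sub_add_cancel], rfl⟩

variable (hA : IsSelfAdjoint A) (hA0 : IsNonneg A)
  (heig : ∀ n, ∃ h : e n ∈ A.domain, A ⟨e n, h⟩ = (μ n ^ 2) • e n)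

include hA hA0 heig

theorem spectralMeasure_diagVec {x : ℕ → ℝ} (hx : Summable fun n => |x n|) :
    spectralMeasure A (diagVec e x) = diagMeasure μ x := by
  refine IsSpectralMeasure.spectralMeasure_eq hA0 ⟨?_, ?_, fun s hs => ?_⟩
  · have : Integrable (fun _ => (1 : ℝ)) (diagMeasure μ x) := by
      rw [integrable_diagMeasure_iff]
      simpa using (summable_sq_of_summable_abs hx).1
    exact (integrable_const_iff_isFiniteMeasure one_ne_zero).1 this
  · rw [diagMeasure, Measure.sum_apply _ measurableSet_Iio]
    simp [sq_nonneg]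
  · obtain ⟨y, hy, ey⟩ := exists_resolvent_diagVec he hA heig hx hs
    refine ⟨y, hy, ?_⟩
    rw [integral_diagMeasure, real_inner_comm, ey]
    have := hasSum_inner_diagVec he hx (diagVec e (fun n => x n * (μ n ^ 2 + s)⁻¹))
    rw [← this.tsum_eq]
    refine tsum_congr fun n => ?_
    rw [inner_orthonormal_diagVec he]
    · ring
    · refine Summable.of_nonneg_of_le (fun _ => abs_nonneg _) (fun n => ?_) (hx.mul_right s⁻¹)
      rw [abs_mul, abs_of_nonneg (by positivity : 0 ≤ (μ n ^ 2 + s)⁻¹)]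
      gcongr
      linarith [sq_nonneg (μ n)]

theorem mem_funDomain_diagVec_iff {x : ℕ → ℝ} (hx : Summable fun n => |x n|) {f : ℝ → ℝ} :
    diagVec e x ∈ funDomain A f ↔ Summable fun n => (x n * f (μ n ^ 2)) ^ 2 := by
  rw [funDomain, mem_ofPred_eq, spectralMeasure_diagVec he hA hA0 heig hx, memLp_diagMeasure_iff]

theorem powNorm_diagVec_le {x : ℕ → ℝ} {α : ℝ}
    (hx : Summable fun n => |x n| * (1 + (μ n ^ 2) ^ α)) :
    diagVec e x ∈ powDomain A α ∧
      powNorm A α (diagVec e x) ≤ ENNReal.ofReal (∑' n, |x n| * (1 + (μ n ^ 2) ^ α)) := by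
  have hpow (n : ℕ) : 0 ≤ (μ n ^ 2) ^ α := by positivity
  have h1 : Summable fun n => |x n| :=
    Summable.of_nonneg_of_le (fun _ => abs_nonneg _)
      (fun n => le_mul_of_one_le_right (abs_nonneg _) (by linarith [hpow n])) hx
  have h2 : Summable fun n => |x n * (μ n ^ 2) ^ α| :=
    Summable.of_nonneg_of_le (fun _ => abs_nonneg _) (fun n => by
      rw [abs_mul, abs_of_nonneg (hpow n)]
      exact mul_le_mul_of_nonneg_left (by linarith) (abs_nonneg _)) hx
  obtain ⟨h3, h4⟩ := summable_sq_of_summable_abs h2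
  refine ⟨(mem_funDomain_diagVec_iff he hA hA0 heig h1 (f := fun l => l ^ α)).2 h3, ?_⟩
  rw [powNorm, funNorm, spectralMeasure_diagVec he hA hA0 heig h1, 
    eLpNorm_diagMeasure (f := fun l => l ^ α) h3,
    ← ofReal_norm, ← ENNReal.ofReal_add (norm_nonneg _) (Real.sqrt_nonneg _)]
  refine ENNReal.ofReal_le_ofReal ?_
  have h5 : √(∑' n, (x n * (μ n ^ 2) ^ α) ^ 2) ≤ ∑' n, |x n * (μ n ^ 2) ^ α| :=
    Real.sqrt_le_iff.2 ⟨tsum_nonneg fun _ => abs_nonneg _, h4⟩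
  refine (add_le_add (norm_diagVec_le he h1) h5).trans_eq ?_
  rw [← h1.tsum_add h2]
  refine tsum_congr fun n => ?_
  rw [abs_mul, abs_of_nonneg (hpow n)]
  ring

theorem sqNormHalf_diagVec {x : ℕ → ℝ} (hx : Summable fun n => |x n|)
    (hx2 : Summable fun n => μ n ^ 2 * x n ^ 2) :
    sqNormHalf A (diagVec e x) = ∑' n, μ n ^ 2 * x n ^ 2 := by
  have e1 (n : ℕ) : (x n * (μ n ^ 2) ^ (1 / 2 : ℝ)) ^ 2 = μ n ^ 2 * x n ^ 2 := by
    rw [mul_pow, ← Real.sqrt_eq_rpow, Real.sq_sqrt (sq_nonneg _), mul_comm]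
  rw [sqNormHalf, funNorm, spectralMeasure_diagVec he hA hA0 heig hx, eLpNorm_diagMeasure]
  · simp only [e1]
    rw [ENNReal.toReal_ofReal (Real.sqrt_nonneg _), Real.sq_sqrt]
    exact tsum_nonneg fun n => by positivity
  · simpa only [e1] using hx2

/-- Dominated convergence for series: continuity and differentiability with values in D(A^α) reduce
to each coefficient, given a summable weighted bound. -/
theorem tendsto_powNorm_diagVec {ι : Type*} {l : Filter ι} {x : ι → ℕ → ℝ} {α : ℝ} {b : ℕ → ℝ}
    (hb : Summable b) (hxb : ∀ᶠ i in l, ∀ n, |x i n| * (1 + (μ n ^ 2) ^ α) ≤ b n)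
    (hx : ∀ n, Tendsto (fun i => x i n) l (𝓝 0)) :
    Tendsto (fun i => powNorm A α (diagVec e (x i))) l (𝓝 0) := by
  have hpow (n : ℕ) : 0 ≤ 1 + (μ n ^ 2) ^ α := by positivity
  have h1 : Tendsto (fun i => ∑' n, |x i n| * (1 + (μ n ^ 2) ^ α)) l (𝓝 (∑' _ : ℕ, (0 : ℝ))) := by
    refine tendsto_tsum_of_dominated_convergence hb (fun n => ?_) ?_
    · simpa using ((hx n).abs).mul_const (1 + (μ n ^ 2) ^ α)
    · filter_upwards [hxb] with i hi n
      rw [Real.norm_of_nonneg (mul_nonneg (abs_nonneg _) (hpow n))]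
      exact hi n
  rw [tsum_zero] at h1
  have h2 := ENNReal.tendsto_ofReal h1
  rw [ENNReal.ofReal_zero] at h2
  refine tendsto_of_tendsto_of_tendsto_of_le_of_le' tendsto_const_nhds h2
    (Eventually.of_forall fun _ => zero_le) ?_
  filter_upwards [hxb] with i hi
  exact (powNorm_diagVec_le he hA hA0 heig (Summable.of_nonneg_of_le
    (fun n => mul_nonneg (abs_nonneg _) (hpow n)) hi hb)).2

end diagVec

end Kirchhoff

namespace Kirchhoff

/-! ### The solution -/

section Solution

variable {H : Type*} [NormedAddCommGroup H] [InnerProductSpace ℝ H] [CompleteSpace H]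
  {e : ℕ → H} {A : H →ₗ.[ℝ] H} {μ : ℕ → ℝ}

theorem contInPow_diagVec (he : Orthonormal ℝ e) (hA : IsSelfAdjoint A) (hA0 : IsNonneg A)
    (heig : ∀ n, ∃ h : e n ∈ A.domain, A ⟨e n, h⟩ = (μ n ^ 2) • e n) {α T : ℝ} (hT : T < 2)
    {f : ℕ → ℝ → ℝ} {b : ℕ → ℝ} (hb : Summable b)
    (hf : ∀ n, ∀ t ∈ Ioo (-1 : ℝ) 2, ContinuousAt (f n) t)
    (hfb : ∀ n, ∀ t ∈ Ioo (-1 : ℝ) 2, |f n t| * (1 + (μ n ^ 2) ^ α) ≤ b n) :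
    ContInPow A α T (fun t => diagVec e (fun n => f n t)) := by
  have hJ {t : ℝ} (ht : t ∈ Icc 0 T) : t ∈ Ioo (-1 : ℝ) 2 :=
    ⟨by linarith [ht.1], by linarith [ht.2]⟩
  have hpow (n : ℕ) : 0 ≤ (μ n ^ 2) ^ α := by positivity
  have hs {t : ℝ} (ht : t ∈ Icc 0 T) : Summable fun n => |f n t| * (1 + (μ n ^ 2) ^ α) :=
    Summable.of_nonneg_of_le (fun n => mul_nonneg (abs_nonneg _) (by linarith [hpow n]))
      (fun n => hfb n t (hJ ht)) hb
  have hs' {t : ℝ} (ht : t ∈ Icc 0 T) : Summable fun n => |f n t| :=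
    Summable.of_nonneg_of_le (fun _ => abs_nonneg _)
      (fun n => le_mul_of_one_le_right (abs_nonneg _) (by linarith [hpow n])) (hs ht)
  intro t ht
  refine ⟨(powNorm_diagVec_le he hA hA0 heig (hs ht)).1, ?_⟩
  have := tendsto_powNorm_diagVec he hA hA0 heig (l := 𝓝[Icc 0 T] t) (α := α)
    (x := fun s n => f n s - f n t) (hb.mul_left 2) ?_ fun n => ?_
  · refine this.congr' ?_
    filter_upwards [self_mem_nhdsWithin] with s hs
    rw [diagVec_sub he (hs' hs) (hs' ht)]
  · filter_upwards [self_mem_nhdsWithin] with s hs n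
    calc |f n s - f n t| * (1 + (μ n ^ 2) ^ α)
        ≤ (|f n s| + |f n t|) * (1 + (μ n ^ 2) ^ α) :=
          mul_le_mul_of_nonneg_right (abs_sub _ _) (by linarith [hpow n])
      _ ≤ 2 * b n := by linarith [hfb n s (hJ hs), hfb n t (hJ ht)]
  · have := ((hf n t (hJ ht)).tendsto.mono_left (nhdsWithin_le_nhds (s := Icc 0 T))).sub_const
      (f n t)
    simpa using this

theorem contDiffInPow_diagVec (he : Orthonormal ℝ e) (hA : IsSelfAdjoint A) (hA0 : IsNonneg A)
    (heig : ∀ n, ∃ h : e n ∈ A.domain, A ⟨e n, h⟩ = (μ n ^ 2) • e n) {α T : ℝ} (hT : T < 2)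
    {f g : ℕ → ℝ → ℝ} {b : ℕ → ℝ} (hb : Summable b)
    (hf : ∀ n, ∀ t ∈ Ioo (-1 : ℝ) 2, HasDerivAt (f n) (g n t) t)
    (hg : ∀ n, ∀ t ∈ Ioo (-1 : ℝ) 2, ContinuousAt (g n) t)
    (hfb : ∀ n, ∀ t ∈ Ioo (-1 : ℝ) 2, |f n t| * (1 + (μ n ^ 2) ^ α) ≤ b n)
    (hgb : ∀ n, ∀ t ∈ Ioo (-1 : ℝ) 2, |g n t| * (1 + (μ n ^ 2) ^ α) ≤ b n) :
    ContDiffInPow A α T (fun t => diagVec e (fun n => f n t))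
      (fun t => diagVec e (fun n => g n t)) := by
  refine ⟨contInPow_diagVec he hA hA0 heig hT hb (fun n t ht => (hf n t ht).continuousAt) hfb,
    contInPow_diagVec he hA hA0 heig hT hb hg hgb, fun t ht => ?_⟩
  have hJ {t : ℝ} (ht : t ∈ Icc 0 T) : t ∈ Ioo (-1 : ℝ) 2 :=
    ⟨by linarith [ht.1], by linarith [ht.2]⟩
  have hpow (n : ℕ) : 0 ≤ (μ n ^ 2) ^ α := by positivity
  have abs_summable {h : ℕ → ℝ → ℝ}
      (hhb : ∀ n, ∀ t ∈ Ioo (-1 : ℝ) 2, |h n t| * (1 + (μ n ^ 2) ^ α) ≤ b n) {t : ℝ}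
      (ht : t ∈ Icc 0 T) : Summable fun n => |h n t| :=
    Summable.of_nonneg_of_le (fun _ => abs_nonneg _)
      (fun n => (le_mul_of_one_le_right (abs_nonneg _) (by linarith [hpow n])).trans
        (hhb n t (hJ ht))) hb
  have hsum {s : ℝ} (hs : s ∈ Icc 0 T) : Summable fun n => |(s - t)⁻¹ * (f n s - f n t)| := by
    refine Summable.abs (Summable.mul_left _ ?_)
    exact (abs_summable hfb hs).of_abs.sub (abs_summable hfb ht).of_abs
  have := tendsto_powNorm_diagVec he hA hA0 heig (l := 𝓝[Icc 0 T \ {t}] t) (α := α)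
    (x := fun s n => (s - t)⁻¹ * (f n s - f n t) - g n t) (hb.mul_left 2) ?_ fun n => ?_
  · refine this.congr' ?_
    filter_upwards [self_mem_nhdsWithin] with s hs
    rw [diagVec_sub he (abs_summable hfb hs.1) (abs_summable hfb ht), smul_diagVec,
      diagVec_sub he (hsum hs.1) (abs_summable hgb ht)]
  · filter_upwards [self_mem_nhdsWithin] with s hs n
    have hp : 0 < 1 + (μ n ^ 2) ^ α := by linarith [hpow n]
    -- The mean value inequality bounds the difference quotients by the same summable sequence as
    -- the derivatives.
    have mv : |f n s - f n t| ≤ b n / (1 + (μ n ^ 2) ^ α) * |s - t| :=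
      (convex_Ioo (-1 : ℝ) 2).norm_image_sub_le_of_norm_hasDerivWithin_le
        (fun x hx => (hf n x hx).hasDerivWithinAt)
        (fun x hx => (le_div_iff₀ hp).2 (hgb n x hx)) (hJ ht) (hJ hs.1)
    have hst : 0 < |s - t| := abs_pos.2 (sub_ne_zero.2 hs.2)
    have h1 : |(s - t)⁻¹ * (f n s - f n t)| * (1 + (μ n ^ 2) ^ α) ≤ b n := by
      rw [abs_mul, abs_inv, ← le_div_iff₀ hp, inv_mul_le_iff₀ hst, mul_comm]
      exact mv
    calc |(s - t)⁻¹ * (f n s - f n t) - g n t| * (1 + (μ n ^ 2) ^ α)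
        ≤ (|(s - t)⁻¹ * (f n s - f n t)| + |g n t|) * (1 + (μ n ^ 2) ^ α) :=
          mul_le_mul_of_nonneg_right (abs_sub _ _) hp.le
      _ ≤ 2 * b n := by linarith [hgb n t (hJ ht)]
  · have h1 := (hasDerivAt_iff_tendsto_slope.1 (hf n t (hJ ht))).mono_left
      (nhdsWithin_mono t (sdiff_subset_compl (Icc 0 T) {t}))
    have := h1.sub_const (g n t)
    rw [sub_self] at this
    exact this

theorem one_add_rpow_quarter_le {x : ℝ} (hx : 0 ≤ x) :
    1 + x ^ (1 / 4 : ℝ) ≤ 2 * (1 + x ^ (3 / 4 : ℝ)) := by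
  have h3 : 0 ≤ x ^ (3 / 4 : ℝ) := by positivity
  rcases le_total x 1 with h | h
  · linarith [Real.rpow_le_one hx h (by norm_num : (0 : ℝ) ≤ 1 / 4)]
  · linarith [Real.rpow_le_rpow_of_exponent_le h (by norm_num : (1 / 4 : ℝ) ≤ 3 / 4)]

/-- A superposition of oscillators solves the nonlinear equation if the coefficient is compatible
with the nonlinearity. -/
theorem isSolution_diagVec (he : Orthonormal ℝ e) (hA : IsSelfAdjoint A) (hA0 : IsNonneg A)
    (heig : ∀ n, ∃ h : e n ∈ A.domain, A ⟨e n, h⟩ = (μ n ^ 2) • e n) {T : ℝ} (hT : T < 2)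
    {c m : ℝ → ℝ} (hc : ∀ t, |c t| ≤ 2) {w v : ℕ → ℝ → ℝ} {b : ℕ → ℝ} (hb : Summable b)
    (hwv : ∀ n, IsOscillator c (μ n) (Ioo (-1) 2) (w n) (v n))
    (hw : ∀ n, ∀ t ∈ Ioo (-1 : ℝ) 2, |w n t| * (1 + (μ n ^ 2) ^ (3 / 4 : ℝ)) ≤ b n)
    (hv : ∀ n, ∀ t ∈ Ioo (-1 : ℝ) 2, |v n t| * (1 + (μ n ^ 2) ^ (1 / 4 : ℝ)) ≤ b n)
    (hm : ∀ t ∈ Icc 0 T, m (sqNormHalf A (diagVec e (fun n => w n t))) = c t) :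
    IsSolution A m T (fun t => diagVec e (fun n => w n t)) (fun t => diagVec e (fun n => v n t)) := by
  have hb0 (n : ℕ) : 0 ≤ b n :=
    (mul_nonneg (abs_nonneg _) (by positivity)).trans (hw n 0 (by norm_num))
  have hw1 (n : ℕ) (t : ℝ) (ht : t ∈ Ioo (-1 : ℝ) 2) : |w n t| ≤ b n :=
    (le_mul_of_one_le_right (abs_nonneg _)
      (by have : 0 ≤ (μ n ^ 2) ^ (3 / 4 : ℝ) := by positivity
          linarith)).trans (hw n t ht)
  have hv1 (n : ℕ) (t : ℝ) (ht : t ∈ Ioo (-1 : ℝ) 2) : |v n t| ≤ b n :=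
    (le_mul_of_one_le_right (abs_nonneg _)
      (by have : 0 ≤ (μ n ^ 2) ^ (1 / 4 : ℝ) := by positivity
          linarith)).trans (hv n t ht)
  have abs_summable {h : ℕ → ℝ → ℝ} (hh : ∀ n, ∀ t ∈ Ioo (-1 : ℝ) 2, |h n t| ≤ b n) {t : ℝ}
      (ht : t ∈ Ioo (-1 : ℝ) 2) : Summable fun n => |h n t| :=
    Summable.of_nonneg_of_le (fun _ => abs_nonneg _) (fun n => hh n t ht) hb
  refine ⟨contDiffInPow_diagVec he hA hA0 heig hT (hb.mul_left 2)
      (fun n t ht => (hwv n t ht).1) (fun n t ht => (hwv n t ht).2.continuousAt)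
      (fun n t ht => ?_) (fun n t ht => ?_),
    contInPow_diagVec he hA hA0 heig hT hb (fun n t ht => (hwv n t ht).1.continuousAt) hw,
    fun y t ht => ?_⟩
  · have := mul_le_mul_of_nonneg_left (one_add_rpow_quarter_le (sq_nonneg (μ n))) (abs_nonneg (w n t))
    linarith [hw n t ht]
  · linarith [hv n t ht, hb0 n]
  · have htJ : t ∈ Ioo (-1 : ℝ) 2 := ⟨by linarith [ht.1], by linarith [ht.2]⟩
    have hder := hasDerivAt_tsum_of_isPreconnected (t := Ioo (-1 : ℝ) 2) (y₀ := t) (y := t)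
      (g := fun n s => v n s * inner ℝ (e n) (y : H))
      (g' := fun n s => -(μ n ^ 2 * c s * w n s) * inner ℝ (e n) (y : H))
      (u := fun n => 2 * ‖A y‖ * b n) (hb.mul_left _) isOpen_Ioo isPreconnected_Ioo
      (fun n s hs => (hwv n s hs).2.mul_const _) (fun n s hs => ?_) htJ
      (hasSum_inner_diagVec he (abs_summable hv1 htJ) y).summable htJ
    · have e1 : ∑' n, -(μ n ^ 2 * c t * w n t) * inner ℝ (e n) (y : H)
          = -(c t * inner ℝ (diagVec e fun n => w n t) (A y)) := by
        rw [← (hasSum_inner_diagVec he (abs_summable hw1 htJ) (A y)).tsum_eq, ← tsum_mul_left,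
          ← tsum_neg]
        refine tsum_congr fun n => ?_
        rw [inner_eigenvector hA heig]
        ring
      rw [hm t ht, ← e1]
      refine (hder.congr_of_eventuallyEq ?_).hasDerivWithinAt
      filter_upwards [Ioo_mem_nhds htJ.1 htJ.2] with s hs
      exact (hasSum_inner_diagVec he (abs_summable hv1 hs) (y : H)).tsum_eq.symm
    -- Moving μ n ² onto y ∈ D(A) leaves a bound with no power of μ n, so the differentiated series
    -- is dominated by `b`.
    · have e2 : -(μ n ^ 2 * c s * w n s) * inner ℝ (e n) (y : H)
          = -(c s * w n s * inner ℝ (e n) (A y)) := by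
        rw [inner_eigenvector hA heig]; ring
      rw [e2, norm_neg, norm_mul, norm_mul, Real.norm_eq_abs, Real.norm_eq_abs]
      have h1 : ‖inner ℝ (e n) (A y)‖ ≤ ‖A y‖ := by
        have := norm_inner_le_norm (𝕜 := ℝ) (e n) (A y)
        rwa [he.1 n, one_mul] at this
      calc |c s| * |w n s| * ‖inner ℝ (e n) (A y)‖ ≤ 2 * b n * ‖A y‖ := by
            have := hc s
            have := hw1 n s hs
            have := hb0 n
            gcongr
        _ = _ := by ring

end Solution

/-- A function with positive derivative at the origin has locally a Lipschitz inverse. -/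
theorem exists_lipschitz_leftInverse {ψ ψ' : ℝ → ℝ}
    (hd : ∀ t ∈ Ioo (-1 : ℝ) 2, HasDerivAt ψ (ψ' t) t) (hc : ContinuousAt ψ' 0) (h0 : 0 < ψ' 0) :
    ∃ T, 0 < T ∧ T < 2 ∧ ∃ (K : ℕ) (τ : ℝ → ℝ), LipschitzWith K τ ∧
      ∀ t ∈ Icc 0 T, τ (ψ t) = t := by
  obtain ⟨r, hr, hr'⟩ := Metric.eventually_nhds_iff.1
    (hc.eventually (Ioi_mem_nhds (half_lt_self h0)))
  set T := min (r / 2) 1 with hT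
  have hT0 : 0 < T := lt_min (by linarith) one_pos
  have hT1 : T ≤ 1 := min_le_right _ _
  have hTr : T < r := (min_le_left _ _).trans_lt (by linarith)
  set δ := ψ' 0 / 2 with hδ
  have hδ0 : 0 < δ := by positivity
  have hJ {t : ℝ} (ht : t ∈ Icc 0 T) : t ∈ Ioo (-1 : ℝ) 2 :=
    ⟨by linarith [ht.1], by linarith [ht.2]⟩
  have hmono {s t : ℝ} (hs : s ∈ Icc 0 T) (ht : t ∈ Icc 0 T) (hst : s ≤ t) :
      δ * (t - s) ≤ ψ t - ψ s := by
    refine (convex_Icc 0 T).mul_sub_le_image_sub_of_le_deriv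
      (fun x hx => (hd x (hJ hx)).continuousAt.continuousWithinAt)
      (fun x hx => (hd x (hJ (interior_subset hx))).differentiableAt.differentiableWithinAt)
      (fun x hx => ?_) s hs t ht hst
    have hx := interior_subset hx
    rw [(hd x (hJ hx)).deriv]
    exact (hr' (by rw [Real.dist_0_eq_abs, abs_of_nonneg hx.1]; linarith [hx.2])).le
  have hexp {s t : ℝ} (hs : s ∈ Icc 0 T) (ht : t ∈ Icc 0 T) : δ * |t - s| ≤ |ψ t - ψ s| := by
    rcases le_total s t with h | h
    · rw [abs_of_nonneg (sub_nonneg.2 h)]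
      exact (hmono hs ht h).trans (le_abs_self _)
    · rw [abs_sub_comm, abs_sub_comm (ψ t), abs_of_nonneg (sub_nonneg.2 h)]
      exact (hmono ht hs h).trans (le_abs_self _)
  have hinj : InjOn ψ (Icc 0 T) := fun s hs t ht hst => by
    have := hexp hs ht
    rw [hst, sub_self, abs_zero] at this
    have h1 : |t - s| ≤ 0 := by
      by_contra hlt
      nlinarith [not_le.1 hlt]
    linarith [abs_nonpos_iff.1 h1]
  -- An integer Lipschitz constant suits the iterated subadditivity of ω.
  obtain ⟨K, hK⟩ := exists_nat_ge (δ⁻¹)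
  have hinv {t : ℝ} (ht : t ∈ Icc 0 T) : Function.invFunOn ψ (Icc 0 T) (ψ t) = t :=
    hinj.leftInvOn_invFunOn ht
  have hLip : LipschitzOnWith K (Function.invFunOn ψ (Icc 0 T)) (ψ '' Icc 0 T) := by
    refine LipschitzOnWith.of_dist_le_mul ?_
    rintro _ ⟨t, ht, rfl⟩ _ ⟨s, hs, rfl⟩
    rw [hinv ht, hinv hs, Real.dist_eq, Real.dist_eq]
    have := hexp hs ht
    rw [mul_comm, ← le_div_iff₀ hδ0, div_eq_inv_mul] at this
    exact this.trans (mul_le_mul_of_nonneg_right hK (abs_nonneg _))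
  -- Extending to the whole line defines the nonlinearity also away from the values taken by ψ.
  obtain ⟨τ, hτ, hτe⟩ := hLip.extend_real
  exact ⟨T, hT0, by linarith, K, τ, hτ, fun t ht => by
    rw [← hτe (mem_image_of_mem ψ ht), hinv ht]⟩

theorem IsContinuityModulus.nat_mul_le {ω : ℝ → ℝ} (hω : IsContinuityModulus ω) (K : ℕ) {x : ℝ}
    (hx : 0 ≤ x) : ω (K * x) ≤ K * ω x := by
  induction K with
  | zero => simp [hω.zero]
  | succ K ih =>
    push_cast
    rw [add_mul, one_mul, add_mul, one_mul]
    exact (hω.subadd _ _ (by positivity) hx).trans (by linarith)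

end Kirchhoff

namespace Kirchhoff

/-! ### Gevrey initial data, derivative loss and conclusion. -/

theorem sq_rpow_sq {x : ℝ} (hx : 0 ≤ x) (α : ℝ) : ((x ^ 2) ^ α) ^ 2 = x ^ (4 * α) := by
  rw [← Real.rpow_natCast, ← Real.rpow_natCast, ← Real.rpow_mul (by positivity),
    ← Real.rpow_mul hx]
  congr 1
  push_cast
  ring

/-- The lower bound δ on the frequencies absorbs the term |x| of the norm into the weighted one. -/
theorem abs_mul_one_add_rpow_le {x y α δ B : ℝ} (hδ : 0 < δ) (hα : 0 ≤ α) (hy : δ ≤ y)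
    (hB : 0 ≤ B) (h : y ^ (4 * α) * x ^ 2 ≤ B ^ 2) :
    |x| * (1 + (y ^ 2) ^ α) ≤ (1 + ((δ ^ 2) ^ α)⁻¹) * B := by
  have hy0 : 0 < y := hδ.trans_le hy
  have h1 : |x| * (y ^ 2) ^ α ≤ B := by
    refine abs_le_of_sq_le_sq' ?_ hB |>.2
    rw [mul_pow, sq_rpow_sq hy0.le, sq_abs, mul_comm]
    exact h
  have hδα : 0 < (δ ^ 2) ^ α := by positivity
  have h2 : (δ ^ 2) ^ α ≤ (y ^ 2) ^ α := by gcongr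
  have h3 : |x| ≤ ((δ ^ 2) ^ α)⁻¹ * B := by
    rw [inv_mul_eq_div, le_div_iff₀ hδα]
    exact (mul_le_mul_of_nonneg_left h2 (abs_nonneg _)).trans h1
  linarith

/-- For fixed r, as soon as n ≥ r the factor exp(-2nφ) absorbs exp(rφ) and exp(-2n) remains. -/
theorem summable_gevrey {φ : ℝ → ℝ} {μ x : ℕ → ℝ} {α r C : ℝ} (hμ : ∀ n, 0 < μ n)
    (hφ : ∀ s, 0 ≤ s → 1 ≤ φ s)
    (hx : ∀ n, 0 < n → μ n ^ (4 * α) * x n ^ 2 ≤ Real.exp (C - 2 * n - 2 * (n * φ (μ n)))) :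
    Summable fun n => (x n * ((μ n ^ 2) ^ α * Real.exp (r * φ √(μ n ^ 2) / 2))) ^ 2 := by
  refine Summable.of_norm_bounded_eventually_nat
    (summable_exp_neg_two_mul.mul_left (Real.exp C)) ?_
  filter_upwards [eventually_gt_atTop 0, eventually_ge_atTop ⌈r⌉₊] with n hn hnr
  have hnr : r ≤ n := Nat.ceil_le.1 hnr
  rw [Real.norm_of_nonneg (sq_nonneg _), Real.sqrt_sq (hμ n).le, mul_pow, mul_pow,
    sq_rpow_sq (hμ n).le, ← Real.exp_nat_mul]
  have h1 := hφ _ (hμ n).le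
  calc x n ^ 2 * (μ n ^ (4 * α) * Real.exp (((2 : ℕ) : ℝ) * (r * φ (μ n) / 2)))
      = μ n ^ (4 * α) * x n ^ 2 * Real.exp (r * φ (μ n)) := by
        push_cast
        ring_nf
    _ ≤ Real.exp (C - 2 * n - 2 * (n * φ (μ n))) * Real.exp (r * φ (μ n)) := by
        gcongr
        exact hx n hn
    _ = Real.exp (C - 2 * n - 2 * (n * φ (μ n)) + r * φ (μ n)) := (Real.exp_add _ _).symm
    _ ≤ Real.exp (C + -2 * n) := by
        refine Real.exp_le_exp.2 ?_
        have h2 : (0 : ℝ) ≤ n := Nat.cast_nonneg n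
        nlinarith [mul_nonneg h2 (zero_le_one.trans h1),
          mul_le_mul_of_nonneg_right hnr (zero_le_one.trans h1)]
    _ = _ := Real.exp_add _ _

/-- By `gap` the extra weight μ n ^ (4η) is at least exp(4ηn S), with S the loss rate. Once 4ηn ≥ C
it outweighs exp(-C S), so the terms of the two series add up to at least 1 and cannot tend to 0. -/
theorem IsResonantSeq.not_summable {φ : ℝ → ℝ} {μ ε : ℕ → ℝ} (h : IsResonantSeq φ μ ε)
    {x y : ℕ → ℝ} {C η : ℝ} (hη : 0 < η)
    (hxy : ∀ᶠ n in atTop,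
      Real.exp (-C * lossRate μ ε n) ≤ μ n * (y n ^ 2 + μ n ^ 2 * x n ^ 2)) :
    ¬ (Summable (fun n => (x n * (μ n ^ 2) ^ (1 / 4 + 1 / 2 + η)) ^ 2) ∧
      Summable fun n => (y n * (μ n ^ 2) ^ (1 / 4 + η)) ^ 2) := by
  rintro ⟨hx, hy⟩
  have hlim := (hx.add hy).tendsto_atTop_zero
  obtain ⟨n, h1, h2, h3, h4⟩ := ((hlim.eventually (Iio_mem_nhds one_pos)).and (hxy.and
    ((eventually_ge_atTop ⌈C / (4 * η)⌉₊).and (eventually_gt_atTop 0)))).exists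
  have hμ := h.mu_pos n
  have h1 : (x n * (μ n ^ 2) ^ (1 / 4 + 1 / 2 + η)) ^ 2 + (y n * (μ n ^ 2) ^ (1 / 4 + η)) ^ 2 < 1 :=
    h1
  have h3 : C ≤ 4 * η * n := by
    rw [← div_le_iff₀' (by positivity)]
    exact Nat.ceil_le.1 h3
  have hS : 0 ≤ lossRate μ ε n := (Nat.cast_nonneg n).trans (h.le_lossRate n)
  have hgap : Real.exp (n * lossRate μ ε n) ≤ μ n := h.gap n h4
  have e1 : μ n ^ (4 * (1 / 4 + 1 / 2 + η)) = μ n ^ (4 * η) * μ n ^ 3 := by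
    rw [← Real.rpow_natCast, ← Real.rpow_add hμ]
    congr 1
    push_cast
    ring
  have e2 : μ n ^ (4 * (1 / 4 + η)) = μ n ^ (4 * η) * μ n := by
    nth_rewrite 3 [← Real.rpow_one (μ n)]
    rw [← Real.rpow_add hμ]
    congr 1
    ring
  rw [mul_pow, mul_pow, sq_rpow_sq hμ.le, sq_rpow_sq hμ.le, e1, e2] at h1
  refine absurd h1 (not_lt.2 ?_)
  calc (1 : ℝ) ≤ Real.exp (4 * η * n * lossRate μ ε n + -C * lossRate μ ε n) := by
        refine Real.one_le_exp ?_
        nlinarith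
    _ = Real.exp (n * lossRate μ ε n) ^ (4 * η) * Real.exp (-C * lossRate μ ε n) := by
        rw [Real.exp_add, ← Real.exp_mul]
        ring_nf
    _ ≤ μ n ^ (4 * η) * (μ n * (y n ^ 2 + μ n ^ 2 * x n ^ 2)) := by
        gcongr
    _ = _ := by ring

theorem hasStrongDerivativeLoss_of_isResonantSeq {H : Type*} [NormedAddCommGroup H]
    [InnerProductSpace ℝ H] [CompleteSpace H] {A : H →ₗ.[ℝ] H} (hA : IsSelfAdjoint A)
    (hA0 : IsNonneg A) {e : ℕ → H} (he : Orthonormal ℝ e) {μ ε : ℕ → ℝ} (hmono : Monotone μ)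
    (heig : ∀ n, ∃ h : e n ∈ A.domain, A ⟨e n, h⟩ = (μ n ^ 2) • e n)
    {ω φ : ℝ → ℝ} (hω : IsContinuityModulus ω) (hφ : ∀ s, 0 ≤ s → 1 ≤ φ s)
    (h : IsResonantSeq φ μ ε) (hεω : ∀ n x, 0 ≤ x → ε n * min 1 (μ n * x) ≤ ω x) :
    ∃ m : ℝ → ℝ, (∀ s, 0 ≤ s → m s ∈ Icc (1 / 2 : ℝ) (3 / 2)) ∧ OmegaContinuous ω m ∧
      ∃ u : ℝ → H, HasStrongDerivativeLoss A m φ (1 / 4) u := by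
  have z : (0 : ℝ) ∈ Ioo (-1) 2 := by norm_num
  obtain ⟨w, v, hwv, ⟨M, hM⟩, hinit, hlate, hpos⟩ := h.exists_modes (h.continuous_coeff hω hεω)
  have hM0 : 0 ≤ M := by
    have := hM 0 0 z
    simp only [Nat.cast_zero, mul_zero, Real.exp_zero, mul_one] at this
    have h0 := h.mu_pos 0
    exact le_trans (by positivity) this
  have hMsq (n : ℕ) : M * Real.exp (-2 * n) = (√M * Real.exp (-n)) ^ 2 := by
    rw [mul_pow, Real.sq_sqrt hM0, ← Real.exp_nat_mul]
    push_cast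
    ring_nf
  have hw2 (n : ℕ) (t : ℝ) (ht : t ∈ Ioo (-1 : ℝ) 2) :
      μ n ^ 3 * w n t ^ 2 ≤ (√M * Real.exp (-n)) ^ 2 := by
    rw [← hMsq]
    refine le_trans ?_ (hM n t ht)
    nlinarith [mul_nonneg (h.mu_pos n).le (sq_nonneg (v n t))]
  have hv2 (n : ℕ) (t : ℝ) (ht : t ∈ Ioo (-1 : ℝ) 2) :
      μ n * v n t ^ 2 ≤ (√M * Real.exp (-n)) ^ 2 := by
    rw [← hMsq]
    refine le_trans ?_ (hM n t ht)
    have := (h.mu_pos n).le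
    have : 0 ≤ μ n * (μ n ^ 2 * w n t ^ 2) := by positivity
    linarith
  set D := 2 + ((μ 0 ^ 2) ^ (3 / 4 : ℝ))⁻¹ + ((μ 0 ^ 2) ^ (1 / 4 : ℝ))⁻¹ with hD
  have hD1 : 0 ≤ ((μ 0 ^ 2) ^ (3 / 4 : ℝ))⁻¹ := by positivity
  have hD2 : 0 ≤ ((μ 0 ^ 2) ^ (1 / 4 : ℝ))⁻¹ := by positivity
  set b : ℕ → ℝ := fun n => D * (√M * Real.exp (-n)) with hbdef
  have hb : Summable b := (Real.summable_exp_neg_nat.mul_left _).mul_left _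
  have hB (n : ℕ) : 0 ≤ √M * Real.exp (-n) := by positivity
  have e3 (n : ℕ) : μ n ^ (4 * (3 / 4) : ℝ) = μ n ^ 3 := by
    rw [← Real.rpow_natCast]; norm_num
  have e1 (n : ℕ) : μ n ^ (4 * (1 / 4) : ℝ) = μ n := by norm_num
  have hw (n : ℕ) (t : ℝ) (ht : t ∈ Ioo (-1 : ℝ) 2) :
      |w n t| * (1 + (μ n ^ 2) ^ (3 / 4 : ℝ)) ≤ b n := by
    refine (abs_mul_one_add_rpow_le (h.mu_pos 0) (by norm_num) (hmono n.zero_le) (hB n)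
      (by rw [e3]; exact hw2 n t ht)).trans (mul_le_mul_of_nonneg_right ?_ (hB n))
    linarith
  have hv (n : ℕ) (t : ℝ) (ht : t ∈ Ioo (-1 : ℝ) 2) :
      |v n t| * (1 + (μ n ^ 2) ^ (1 / 4 : ℝ)) ≤ b n := by
    refine (abs_mul_one_add_rpow_le (h.mu_pos 0) (by norm_num) (hmono n.zero_le) (hB n)
      (by rw [e1]; exact hv2 n t ht)).trans (mul_le_mul_of_nonneg_right ?_ (hB n))
    linarith
  have hsum {f : ℕ → ℝ → ℝ} {α : ℝ}
      (hf : ∀ n, ∀ t ∈ Ioo (-1 : ℝ) 2, |f n t| * (1 + (μ n ^ 2) ^ α) ≤ b n) {t : ℝ}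
      (ht : t ∈ Ioo (-1 : ℝ) 2) : Summable fun n => |f n t| :=
    Summable.of_nonneg_of_le (fun _ => abs_nonneg _)
      (fun n => (le_mul_of_one_le_right (abs_nonneg _)
        (by have : 0 ≤ (μ n ^ 2) ^ α := by positivity
            linarith)).trans (hf n t ht)) hb
  have hexp : Summable fun n : ℕ => M * Real.exp (-2 * n) := summable_exp_neg_two_mul.mul_left _
  have hψs {t : ℝ} (ht : t ∈ Ioo (-1 : ℝ) 2) : Summable fun n => μ n ^ 2 * w n t ^ 2 := by
    refine Summable.of_nonneg_of_le (fun n => by positivity) (fun n => ?_)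
      (hexp.mul_left (μ 0)⁻¹)
    rw [inv_mul_eq_div, le_div_iff₀ (h.mu_pos 0)]
    have h1 := hmono n.zero_le
    have h2 := hw2 n t ht
    rw [← hMsq] at h2
    calc μ n ^ 2 * w n t ^ 2 * μ 0 ≤ μ n ^ 2 * w n t ^ 2 * μ n := by gcongr
      _ = μ n ^ 3 * w n t ^ 2 := by ring
      _ ≤ _ := h2
  have hψb (n : ℕ) (t : ℝ) (ht : t ∈ Ioo (-1 : ℝ) 2) :
      ‖2 * (μ n ^ 2 * (w n t * v n t))‖ ≤ 2 * (M * Real.exp (-2 * n)) := by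
    rw [Real.norm_eq_abs, abs_mul, abs_two]
    linarith [abs_mul_le_energy (x := w n t) (y := v n t) (h.mu_pos n), hM n t ht]
  have hψ (t : ℝ) (ht : t ∈ Ioo (-1 : ℝ) 2) :
      HasDerivAt (fun t => ∑' n, μ n ^ 2 * w n t ^ 2)
        (∑' n, 2 * (μ n ^ 2 * (w n t * v n t))) t := by
    refine hasDerivAt_tsum_of_isPreconnected (hexp.mul_left 2) isOpen_Ioo isPreconnected_Ioo
      (fun n s hs => ?_) hψb ht (hψs ht) ht
    convert! ((hwv n s hs).1.pow 2).const_mul (μ n ^ 2) using 1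
    push_cast
    ring
  have hψ'c : ContinuousAt (fun t => ∑' n, 2 * (μ n ^ 2 * (w n t * v n t))) 0 := by
    refine (continuousOn_tsum (s := Ioo (-1) 2) (fun n t ht => ?_) (hexp.mul_left 2)
      hψb).continuousAt (Ioo_mem_nhds z.1 z.2)
    exact ((((hwv n t ht).1.continuousAt.mul (hwv n t ht).2.continuousAt).const_mul _).const_mul
      _).continuousWithinAt
  -- The derivative of ψ at 0 is twice the series made positive by mode 0.
  obtain ⟨T, hT0, hT2, K, τ, hτ, hτψ⟩ := exists_lipschitz_leftInverse hψ hψ'c (by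
    rw [tsum_mul_left]
    linarith)
  have hJ {t : ℝ} (ht : t ∈ Icc 0 T) : t ∈ Ioo (-1 : ℝ) 2 :=
    ⟨by linarith [ht.1], by linarith [ht.2]⟩
  -- Composing with `τ` gives m(ψ t) = `coeff` at t on [0, T]; the bounds hold everywhere because
  -- they hold for `coeff` at all times.
  refine ⟨fun σ => coeff μ ε (τ σ), fun σ _ => h.coeff_mem _, ⟨64 * K, fun x y _ _ => ?_⟩,
    fun t => diagVec e (fun n => w n t), T, hT0, fun t => diagVec e (fun n => v n t),
    isSolution_diagVec he hA hA0 heig hT2 (c := coeff μ ε) (fun t => ?_) hb hwv hw hv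
      fun t ht => ?_, fun r hr => ?_, fun r hr => ?_, fun η hη t ht => ?_⟩
  · refine (h.abs_coeff_sub_le hεω _ _).trans ?_
    have h1 : |τ x - τ y| ≤ K * |x - y| := by
      simpa [Real.dist_eq] using hτ.dist_le_mul x y
    have h2 := hω.monotoneOn (mem_Ici.2 (abs_nonneg _))
      (mem_Ici.2 ((abs_nonneg _).trans h1)) h1
    have h3 := hω.nat_mul_le K (abs_nonneg (x - y))
    linarith
  · have := h.coeff_mem t
    exact abs_le.2 ⟨by linarith [this.1], by linarith [this.2]⟩
  · rw [sqNormHalf_diagVec he hA hA0 heig (hsum hw (hJ ht)) (hψs (hJ ht)), hτψ t ht]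
  · refine (mem_funDomain_diagVec_iff he hA hA0 heig (hsum hw z)
      (f := fun l => l ^ (3 / 4 : ℝ) * Real.exp (r * φ √l / 2))).2
      (summable_gevrey (x := fun n => w n 0) (α := 3 / 4) (r := r) h.mu_pos hφ (C := 14)
        fun n hn => ?_)
    refine le_trans ?_ (hinit n hn)
    have := mul_nonneg (h.mu_pos n).le (sq_nonneg (v n 0))
    rw [e3]
    nlinarith
  · refine (mem_funDomain_diagVec_iff he hA hA0 heig (hsum hv z)
      (f := fun l => l ^ (1 / 4 : ℝ) * Real.exp (r * φ √l / 2))).2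
      (summable_gevrey (x := fun n => v n 0) (α := 1 / 4) (r := r) h.mu_pos hφ (C := 14)
        fun n hn => ?_)
    refine le_trans ?_ (hinit n hn)
    have := (h.mu_pos n).le
    have : 0 ≤ μ n * (μ n ^ 2 * w n 0 ^ 2) := by positivity
    rw [e1]
    linarith
  · have htJ := hJ (Ioc_subset_Icc_self ht)
    rintro ⟨hu, hu'⟩
    refine h.not_summable (x := fun n => w n t) (y := fun n => v n t) (C := 300) hη ?_
      ⟨(mem_funDomain_diagVec_iff he hA hA0 heig (hsum hw htJ)
        (f := fun l => l ^ (1 / 4 + 1 / 2 + η))).1 hu,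
        (mem_funDomain_diagVec_iff he hA hA0 heig (hsum hv htJ)
        (f := fun l => l ^ (1 / 4 + η))).1 hu'⟩
    have hlim : Tendsto (fun n : ℕ => 2 * (1 / 2 : ℝ) ^ n) atTop (𝓝 0) := by
      simpa using (tendsto_pow_atTop_nhds_zero_of_lt_one (by norm_num : (0 : ℝ) ≤ 1 / 2)
        (by norm_num)).const_mul 2
    -- At a fixed t > 0 the n-th burst is over as soon as 2·2⁻ⁿ ≤ t.
    filter_upwards [hlim.eventually (Iic_mem_nhds ht.1), eventually_gt_atTop 0] with n h1 hn
    exact hlate n hn t ⟨h1, htJ.2⟩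

end Kirchhoff

theorem mainTheorem4 {H : Type*} [NormedAddCommGroup H] [InnerProductSpace ℝ H] [CompleteSpace H]
    (A : H →ₗ.[ℝ] H) (hA : IsSelfAdjoint A) (hA0 : Kirchhoff.IsNonneg A)
    (e : ℕ → H) (he : Orthonormal ℝ e)
    (lam : ℕ → ℝ) (hlam_pos : ∀ k, 0 < lam k) (hlam_mono : Monotone lam)
    (hlam_unbdd : Tendsto lam atTop atTop)
    (heig : ∀ k, ∃ h : e k ∈ A.domain, A ⟨e k, h⟩ = (lam k ^ 2) • e k)
    (ω : ℝ → ℝ) (hω : Kirchhoff.IsContinuityModulus ω)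
    (hω' : MonotoneOn (fun s => s / ω s) (Ioi 0))
    (φ : ℝ → ℝ) (hφ : ∀ s, 0 ≤ s → 1 ≤ φ s)
    (hlim : Tendsto (fun k => lam k / φ (lam k) * ω (1 / lam k)) atTop atTop) :
    ∃ m : ℝ → ℝ, (∀ s, 0 ≤ s → m s ∈ Icc (1 / 2 : ℝ) (3 / 2)) ∧
      Kirchhoff.OmegaContinuous ω m ∧
      ∃ u : ℝ → H, Kirchhoff.HasStrongDerivativeLoss A m φ (1 / 4) u := by
  obtain ⟨k, hk, ε, h, hεω⟩ := Kirchhoff.exists_isResonantSeq hlam_pos hlam_mono hlam_unbdd hω hω'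
    hφ hlim
  exact Kirchhoff.hasStrongDerivativeLoss_of_isResonantSeq hA hA0 (he.comp k hk.injective)
    (hlam_mono.comp hk.monotone) (fun n => heig (k n)) hω hφ h hεω
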